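/- Let $\theta(z;p)=\prod_{j\ge 0}(1-zp^j)(1-p^{j+1}/z)$ for complex $z\neq 0$ and $|p|<1$, and put $(a;q,p)_n=\prod_{j=0}^{n-1}\theta(aq^j;p)$, $(a;q)_n=(a;q,0)_n=\prod_{j=0}^{n-1}(1-aq^j)$. Sequences $\alpha_n=\alpha_n(a,k;q,p)$, $\beta_n=\beta_n(a,k;q,p)$ $(n\ge 0)$ form an elliptic WP Bailey pair at $(a,k;q,p)$ if for all $n\ge 0$ $$\beta_n=\sum_{r=0}^n\frac{(k/a;q,p)_{n-r}}{(q;q,p)_{n-r}}\frac{(k;q,p)_{n+r}}{(aq;q,p)_{n+r}}\,\alpha_r,$$ $$\alpha_n=\frac{\theta(aq^{2n};p)}{\theta(a;p)}\sum_{r=0}^n\frac{\theta(kq^{2r};p)}{\theta(k;p)}\frac{(a/k;q,p)_{n-r}}{(q;q,p)_{n-r}}\frac{(a;q,p)_{n+r}}{(kq;q,p)_{n+r}}\Bigl(\frac ka\Bigr)^{n-r}\beta_r.$$ A (basic) WP Bailey pair at $(a,k;q)$ is defined by the same two equations with $\theta(z;p)$ replaced by $1-z$ and $(z;q,p)_n$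 by $(z;q)_n$. **Theorem.** Let $a,k,q$ be nonzero complex numbers and $m=k^2/a$. Given $\alpha_n$ and $\beta_n$, define $$\alpha'_{2n}(a,k;q,p)=\alpha_n(a,m;q^2,p),\qquad \alpha'_{2n+1}(a,k;q,p)=0,$$ $$\beta'_n(a,k;q,p)=\frac{(mq;q^2,p)_n}{(aq;q^2,p)_n}\sum_{r=0}^{\lfloor n/2\rfloor}\frac{\theta(mq^{4r};p)}{\theta(m;p)}\frac{(k/m;q,p)_{n-2r}}{(q;q,p)_{n-2r}}\frac{(k;q,p)_{n+2r}}{(mq;q,p)_{n+2r}}\Bigl(-\frac ka\Bigr)^{n-2r}\beta_r(a,m;q^2,p).$$ 1. Let $|p|<1$ and suppose that $\theta(q^{j+1};p)$, $\theta(aq^j;p)$, $\theta(kq^j;p)$, $\theta(mq^j;p)$ are nonzero for all $j\ge 0$. If $(\alpha,\beta)$ is an elliptic WP Bailey pair at $(a,m;q^2,p)$, then $(\alpha',\beta')$ is an elliptic WP Bailey pair at $(a,k;q,p)$. 2. Suppose that $q^{j+1}$, $aq^j$, $kq^j$, $mq^j$ are all different from $1$ for $j\ge 0$. For sequences $\alpha_n(a,m;q^2)$,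 $\beta_n(a,m;q^2)$ let $\alpha'_n(a,k;q)$, $\beta'_n(a,k;q)$ be given by the formulas above with $\theta(z;p)$ replaced by $1-z$ and $(z;q,p)_n$ by $(z;q)_n$. If $(\alpha,\beta)$ is a WP Bailey pair at $(a,m;q^2)$, then $(\alpha',\beta')$ is a WP Bailey pair at $(a,k;q)$. Moreover this is the limit $p\to0$ of the elliptic transformation: if $\alpha_n(a,m;q^2,p)\to\alpha_n(a,m;q^2)$ and $\beta_n(a,m;q^2,p)\to\beta_n(a,m;q^2)$ for all $n$ as $p\to 0$ ($p\ne0$), then $\alpha'_n(a,k;q,p)\to\alpha'_n(a,k;q)$ and $\beta'_n(a,k;q,p)\to\beta'_n(a,k;q)$ for all $n$. -/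

import Mathlib

open Filter Topology

/-- The modified Jacobi theta function
`θ(z;p) = ∏_{j ≥ 0} (1 - z p^j)(1 - p^{j+1}/z)`, for `z ≠ 0` and `|p| < 1`
(the product then converges absolutely; `θ(z;0) = 1 - z`). -/
noncomputable def modTheta (z p : ℂ) : ℂ :=
  ∏' j : ℕ, ((1 - z * p ^ j) * (1 - p ^ (j + 1) / z))

/-- The elliptic shifted factorial `(a;q,p)_n = ∏_{j < n} θ(a q^j;p)`. -/
noncomputable def ellPoch (a q p : ℂ) (n : ℕ) : ℂ :=
  ∏ j ∈ Finset.range n, modTheta (a * q ^ j) p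

/-- The `q`-shifted factorial `(a;q)_n = ∏_{j < n} (1 - a q^j)`. -/
noncomputable def basicPoch (a q : ℂ) (n : ℕ) : ℂ :=
  ∏ j ∈ Finset.range n, (1 - a * q ^ j)

/-- The families `α_n(a,k;q,p)`, `β_n(a,k;q,p)` (written `α n a k q p`, `β n a k q p`) form an
elliptic WP Bailey pair at the parameters `a, k, q, p`: both equations of the
elliptic WP Bailey transform hold for all `n`. -/
def IsEllipticWPBaileyPair (α β : ℕ → ℂ → ℂ → ℂ → ℂ → ℂ) (a k q p : ℂ) : Prop :=
  (∀ n : ℕ, β n a k q p =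
    ∑ r ∈ Finset.range (n + 1),
      ellPoch (k / a) q p (n - r) / ellPoch q q p (n - r) *
        (ellPoch k q p (n + r) / ellPoch (a * q) q p (n + r)) * α r a k q p) ∧
  (∀ n : ℕ, α n a k q p =
    modTheta (a * q ^ (2 * n)) p / modTheta a p *
      ∑ r ∈ Finset.range (n + 1),
        modTheta (k * q ^ (2 * r)) p / modTheta k p *
          (ellPoch (a / k) q p (n - r) / ellPoch q q p (n - r)) *
          (ellPoch a q p (n + r) / ellPoch (k * q) q p (n + r)) *
          (k / a) ^ (n - r) * β r a k q p)

/-- The families `α_n(a,k;q)`, `β_n(a,k;q)` form a (basic) WP Bailey pair at the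
parameters `a, k, q`: both equations of the WP Bailey transform hold for all `n`. -/
def IsBasicWPBaileyPair (α β : ℕ → ℂ → ℂ → ℂ → ℂ) (a k q : ℂ) : Prop :=
  (∀ n : ℕ, β n a k q =
    ∑ r ∈ Finset.range (n + 1),
      basicPoch (k / a) q (n - r) / basicPoch q q (n - r) *
        (basicPoch k q (n + r) / basicPoch (a * q) q (n + r)) * α r a k q) ∧
  (∀ n : ℕ, α n a k q =
    (1 - a * q ^ (2 * n)) / (1 - a) *
      ∑ r ∈ Finset.range (n + 1),
        (1 - k * q ^ (2 * r)) / (1 - k) *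
          (basicPoch (a / k) q (n - r) / basicPoch q q (n - r)) *
          (basicPoch a q (n + r) / basicPoch (k * q) q (n + r)) *
          (k / a) ^ (n - r) * β r a k q)

/-- `α'_{2n}(a,k;q,p) = α_n(a,m;q²,p)` and `α'_{2n+1}(a,k;q,p) = 0`, with `m = k²/a`. -/
noncomputable def ellAlphaNew (α : ℕ → ℂ → ℂ → ℂ → ℂ → ℂ) (n : ℕ) (a k q p : ℂ) : ℂ :=
  if Even n then α (n / 2) a (k ^ 2 / a) (q ^ 2) p else 0

/-- `β'_n(a,k;q,p)`, a sum over `0 ≤ r ≤ ⌊n/2⌋` of multiples of `β_r(a,m;q²,p)`,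
with `m = k²/a`. -/
noncomputable def ellBetaNew (β : ℕ → ℂ → ℂ → ℂ → ℂ → ℂ) (n : ℕ) (a k q p : ℂ) : ℂ :=
  let m := k ^ 2 / a
  ellPoch (m * q) (q ^ 2) p n / ellPoch (a * q) (q ^ 2) p n *
    ∑ r ∈ Finset.range (n / 2 + 1),
      modTheta (m * q ^ (4 * r)) p / modTheta m p *
        (ellPoch (k / m) q p (n - 2 * r) / ellPoch q q p (n - 2 * r)) *
        (ellPoch k q p (n + 2 * r) / ellPoch (m * q) q p (n + 2 * r)) *
        (-(k / a)) ^ (n - 2 * r) * β r a m (q ^ 2) p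

/-- The basic analogue of `ellAlphaNew`. -/
noncomputable def basicAlphaNew (α : ℕ → ℂ → ℂ → ℂ → ℂ) (n : ℕ) (a k q : ℂ) : ℂ :=
  if Even n then α (n / 2) a (k ^ 2 / a) (q ^ 2) else 0

/-- The basic analogue of `ellBetaNew`. -/
noncomputable def basicBetaNew (β : ℕ → ℂ → ℂ → ℂ → ℂ) (n : ℕ) (a k q : ℂ) : ℂ :=
  let m := k ^ 2 / a
  basicPoch (m * q) (q ^ 2) n / basicPoch (a * q) (q ^ 2) n *
    ∑ r ∈ Finset.range (n / 2 + 1),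
      (1 - m * q ^ (4 * r)) / (1 - m) *
        (basicPoch (k / m) q (n - 2 * r) / basicPoch q q (n - 2 * r)) *
        (basicPoch k q (n + 2 * r) / basicPoch (m * q) q (n + 2 * r)) *
        (-(k / a)) ^ (n - 2 * r) * β r a m (q ^ 2)

/-! Insert the first equation of the given pair into `β'_n` and exchange the two sums. The claim
becomes that the coefficient of `α_j(a,m;q²,p)` is the Bailey kernel at `(n, 2j)`. After pulling out
the factorials of length `4j` and replacing `a, k, m` by their multiples by `q^(4j)`, this is a
quadratic elliptic summation (`sum_quadTerm_eq`), valid under `a m = k²`. The second equation of the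
new pair then follows from the first by inversion (`bailey_inversion`).

The quadratic summation is proved by a recursion in its length: the sum `S_(n+1)(a,k,m)` is a
combination of `S_n(a,k,m)` and `S_(n-1)(aq²,kq³,mq⁴)`. It holds summand by summand, and the closed
form obeys it too. The inversion rests on an orthogonality relation whose partial sums have a closed
form.

Once the factorials are cancelled, each of these recursions is an instance of the theta addition
formula (`modTheta_addition`). That formula comes from the Jacobi triple product: splitting a
product of two theta series by parity writes `θ(xy)θ(x/y)` as a `2 × 2` determinant, and the
addition formula is the Plücker relation between such determinants.

The basic transformation is the elliptic one at `p = 0`, where `θ(z;0) = 1 - z`; the limit statement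
uses continuity of `θ(z;p)` in `p` at `0`. -/

/-! ### The Jacobi triple product -/

/-- The reciprocal `1 / (p;p)_k`, extended by `0` to negative `k`. -/
noncomputable def invPoch (p : ℂ) (k : ℤ) : ℂ :=
  if k < 0 then 0 else (basicPoch p p k.toNat)⁻¹

lemma one_sub_pow_ne_zero {p : ℂ} (hp : ‖p‖ < 1) (n : ℕ) : 1 - p * p ^ n ≠ 0 := by
  intro h
  have h1 : p ^ (n + 1) = 1 := by rw [pow_succ']; linear_combination -h
  have h2 : ‖p‖ ^ (n + 1) = 1 := by rw [← norm_pow, h1, norm_one]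
  exact absurd h2 (pow_lt_one₀ (norm_nonneg _) hp (Nat.succ_ne_zero n)).ne

lemma basicPoch_self_ne_zero {p : ℂ} (hp : ‖p‖ < 1) (n : ℕ) : basicPoch p p n ≠ 0 :=
  Finset.prod_ne_zero_iff.2 fun j _ => one_sub_pow_ne_zero hp j

/-- The extension by zero is consistent because `1 - p^k` vanishes at `k = 0`. The finite triple
product can therefore be summed over all of `ℤ` with no boundary cases. -/
lemma invPoch_sub_one {p : ℂ} (hp : ‖p‖ < 1) (k : ℤ) :
    invPoch p (k - 1) = (1 - p ^ k) * invPoch p k := by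
  rcases lt_trichotomy k 0 with h | rfl | h
  · simp [invPoch, h, show k - 1 < 0 by omega]
  · simp [invPoch]
  · obtain ⟨n, rfl⟩ : ∃ n : ℕ, k = n + 1 := ⟨(k - 1).toNat, by omega⟩
    have h1 : ¬ ((n : ℤ) + 1 - 1 < 0) := by omega
    have h2 : ¬ ((n : ℤ) + 1 < 0) := by omega
    have h3 : ((n : ℤ) + 1 - 1).toNat = n := by omega
    have h4 : ((n : ℤ) + 1).toNat = n + 1 := by omega
    have h5 : p ^ ((n : ℤ) + 1) = p * p ^ n := by
      rw [← Nat.cast_succ, zpow_natCast, pow_succ']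
    have h6 := one_sub_pow_ne_zero hp n
    have h7 := basicPoch_self_ne_zero hp n
    have h8 : basicPoch p p (n + 1) = basicPoch p p n * (1 - p * p ^ n) :=
      Finset.prod_range_succ _ _
    rw [invPoch, invPoch, if_neg h1, if_neg h2, h3, h4, h5, h8]
    field_simp

/-- The general term of the theta series in base `r ^ 2`. -/
noncomputable def thetaTerm (r z : ℂ) (n : ℤ) : ℂ := (-1) ^ n * r ^ (n ^ 2 - n) * z ^ n

/-- A square root `r` of the nome replaces `p^(n(n-1)/2)` by `r^(n²-n)`, so no halves occur. This
ratio drives both the convergence tests and the finite triple product. -/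
lemma thetaTerm_add_one {r z : ℂ} (hr : r ≠ 0) (hz : z ≠ 0) (n : ℤ) :
    thetaTerm r z (n + 1) = -(r ^ (2 * n) * z) * thetaTerm r z n := by
  rw [thetaTerm, thetaTerm, show (n + 1) ^ 2 - (n + 1) = (n ^ 2 - n) + 2 * n by ring,
    zpow_add₀ hr, zpow_add₀ hz, zpow_add₀ (by norm_num : (-1 : ℂ) ≠ 0)]
  simp only [zpow_one]
  ring

lemma thetaTerm_ne_zero {r z : ℂ} (hr : r ≠ 0) (hz : z ≠ 0) (n : ℤ) : thetaTerm r z n ≠ 0 :=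
  mul_ne_zero (mul_ne_zero (zpow_ne_zero _ (by norm_num)) (zpow_ne_zero _ hr)) (zpow_ne_zero _ hz)

lemma norm_sq_lt_one {r : ℂ} (hr1 : ‖r‖ < 1) : ‖r ^ 2‖ < 1 := by
  rw [norm_pow]; exact pow_lt_one₀ (norm_nonneg _) hr1 two_ne_zero

lemma summable_thetaTerm {r z : ℂ} (hr : r ≠ 0) (hz : z ≠ 0) (hr1 : ‖r‖ < 1) :
    Summable (thetaTerm r z) := by
  have key := tendsto_pow_atTop_nhds_zero_of_norm_lt_one (norm_sq_lt_one hr1)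
  apply Summable.of_nat_of_neg
  · refine summable_of_ratio_test_tendsto_lt_one zero_lt_one
      (Eventually.of_forall fun n => thetaTerm_ne_zero hr hz _) ?_
    have h : Tendsto (fun n : ℕ => ‖(r ^ 2) ^ n * z‖) atTop (𝓝 0) := by
      simpa using (key.mul_const z).norm
    refine h.congr fun n => ?_
    rw [Nat.cast_succ, thetaTerm_add_one hr hz, norm_mul (-_),
      mul_div_cancel_right₀ _ (norm_ne_zero_iff.2 (thetaTerm_ne_zero hr hz _)), norm_neg,
      zpow_mul, zpow_natCast, zpow_ofNat]
  · refine summable_of_ratio_test_tendsto_lt_one zero_lt_one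
      (Eventually.of_forall fun n => thetaTerm_ne_zero hr hz _) ?_
    have h : Tendsto (fun n : ℕ => ‖(r ^ 2) ^ (n + 1) / z‖) atTop (𝓝 0) := by
      simpa using (((tendsto_add_atTop_iff_nat 1).2 key).div_const z).norm
    refine h.congr fun n => ?_
    have h1 := thetaTerm_add_one hr hz (-((n + 1 : ℕ) : ℤ))
    rw [show -((n + 1 : ℕ) : ℤ) + 1 = -(n : ℤ) by push_cast; ring] at h1
    rw [h1, ← norm_div, ← norm_neg]
    congr 1
    have h2 := thetaTerm_ne_zero hr hz (-((n + 1 : ℕ) : ℤ))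
    have h3 : r ^ (2 * -((n + 1 : ℕ) : ℤ)) = ((r ^ 2) ^ (n + 1))⁻¹ := by
      rw [zpow_mul, zpow_neg, zpow_natCast, zpow_ofNat]
    rw [h3]
    field_simp

/-- The finite form of the Jacobi triple product identity. -/
lemma hasSum_finite_triple_product {r z : ℂ} (hr : r ≠ 0) (hz : z ≠ 0) (hr1 : ‖r‖ < 1) (N : ℕ) :
    HasSum (fun n : ℤ => basicPoch (r ^ 2) (r ^ 2) (2 * N) * invPoch (r ^ 2) (N - n) *
        invPoch (r ^ 2) (N + n) * thetaTerm r z n)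
      (∏ j ∈ Finset.range N, ((1 - z * (r ^ 2) ^ j) * (1 - (r ^ 2) ^ (j + 1) / z))) := by
  have hp := norm_sq_lt_one hr1
  induction N with
  | zero =>
    convert hasSum_single (0 : ℤ) ?_ using 1
    · simp [invPoch, basicPoch, thetaTerm]
    · intro n hn
      rcases lt_or_gt_of_ne hn with h | h
      · simp [invPoch, h]
      · simp [invPoch, h]
  | succ N ih =>
    set f : ℤ → ℂ := fun n => basicPoch (r ^ 2) (r ^ 2) (2 * N) * invPoch (r ^ 2) (N - n) *
        invPoch (r ^ 2) (N + n) * thetaTerm r z n with hf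
    -- Expanding the new factor gives multiples of the old product by `1 + p^(2N+1)`, `-z p^N` and
    -- `-p^(N+1)/z`, where `p = r²`. Shifting the index by one absorbs the powers `z` and `z⁻¹`,
    -- after which the series agree term by term.
    have hm := (Equiv.subRight (1 : ℤ)).hasSum_iff.2 ih
    have hpl := (Equiv.addRight (1 : ℤ)).hasSum_iff.2 ih
    have hsum := ((ih.mul_left (1 + (r ^ 2) ^ (2 * N + 1))).sub
      (hm.mul_left (z * (r ^ 2) ^ N))).sub (hpl.mul_left ((r ^ 2) ^ (N + 1) / z))
    rw [Finset.prod_range_succ]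
    have hval : ∀ F : ℂ, F * ((1 - z * (r ^ 2) ^ N) * (1 - (r ^ 2) ^ (N + 1) / z)) =
        (1 + (r ^ 2) ^ (2 * N + 1)) * F - z * (r ^ 2) ^ N * F - (r ^ 2) ^ (N + 1) / z * F := by
      intro F
      have : (r ^ 2) ^ (2 * N + 1) = (r ^ 2) ^ N * (r ^ 2) ^ (N + 1) := by ring
      rw [this]
      field_simp
      ring
    rw [hval]
    convert hsum using 1
    · rfl
    · funext n
      have e1 := invPoch_sub_one hp (N + 1 - n)
      have e2 := invPoch_sub_one hp (N - n)
      have e3 := invPoch_sub_one hp (N + 1 + n)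
      have e4 := invPoch_sub_one hp (N + n)
      rw [show (N : ℤ) + 1 - n - 1 = N - n by ring] at e1
      rw [show (N : ℤ) + 1 + n - 1 = N + n by ring] at e3
      have t1 := thetaTerm_add_one hr hz n
      have t2 := thetaTerm_add_one hr hz (n - 1)
      rw [sub_add_cancel] at t2
      have hb : basicPoch (r ^ 2) (r ^ 2) (2 * (N + 1)) = basicPoch (r ^ 2) (r ^ 2) (2 * N) *
          (1 - r ^ 2 * (r ^ 2) ^ (2 * N)) * (1 - r ^ 2 * (r ^ 2) ^ (2 * N + 1)) := by
        rw [basicPoch, show 2 * (N + 1) = 2 * N + 1 + 1 by ring, Finset.prod_range_succ,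
          Finset.prod_range_succ, ← basicPoch]
      have a1 : f ((Equiv.subRight (1 : ℤ)) n) = basicPoch (r ^ 2) (r ^ 2) (2 * N) *
          invPoch (r ^ 2) (N + 1 - n) * invPoch (r ^ 2) (N + n - 1) * thetaTerm r z (n - 1) := by
        simp only [hf, Equiv.subRight_apply]
        rw [show (N : ℤ) - (n - 1) = N + 1 - n by ring, show (N : ℤ) + (n - 1) = N + n - 1 by ring]
      have a2 : f ((Equiv.addRight (1 : ℤ)) n) = basicPoch (r ^ 2) (r ^ 2) (2 * N) *
          invPoch (r ^ 2) (N - n - 1) * invPoch (r ^ 2) (N + 1 + n) * thetaTerm r z (n + 1) := by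
        simp only [hf, Equiv.coe_addRight]
        rw [show (N : ℤ) - (n + 1) = N - n - 1 by ring, show (N : ℤ) + (n + 1) = N + 1 + n by ring]
      simp only [Function.comp_apply]
      rw [a1, a2, t1, e2, e1, e4, e3, hb]
      simp only [hf]
      rw [e1, e3]
      have hcast1 : ((N + 1 : ℕ) : ℤ) - n = N + 1 - n := by push_cast; ring
      have hcast2 : ((N + 1 : ℕ) : ℤ) + n = N + 1 + n := by push_cast; ring
      rw [hcast1, hcast2, t2]
      have hr2 : (r ^ 2) ≠ 0 := pow_ne_zero _ hr
      have z1 : (r ^ 2) ^ ((N : ℤ) + 1 - n) = (r ^ 2) ^ N * r ^ 2 / (r ^ 2) ^ n := by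
        rw [zpow_sub₀ hr2, zpow_add₀ hr2, zpow_natCast, zpow_one]
      have z2 : (r ^ 2) ^ ((N : ℤ) - n) = (r ^ 2) ^ N / (r ^ 2) ^ n := by
        rw [zpow_sub₀ hr2, zpow_natCast]
      have z3 : (r ^ 2) ^ ((N : ℤ) + 1 + n) = (r ^ 2) ^ N * r ^ 2 * (r ^ 2) ^ n := by
        rw [zpow_add₀ hr2, zpow_add₀ hr2, zpow_natCast, zpow_one]
      have z4 : (r ^ 2) ^ ((N : ℤ) + n) = (r ^ 2) ^ N * (r ^ 2) ^ n := by
        rw [zpow_add₀ hr2, zpow_natCast]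
      have z5 : r ^ (2 * n) = (r ^ 2) ^ n := by rw [zpow_mul, zpow_ofNat]
      have z6 : r ^ (2 * (n - 1)) = (r ^ 2) ^ n / r ^ 2 := by
        rw [zpow_mul, zpow_sub₀ (by simpa using hr), zpow_ofNat, zpow_one]
      rw [z1, z2, z3, z4, z5, z6]
      have hX : (r ^ 2) ^ n ≠ 0 := zpow_ne_zero _ hr2
      have hP : (r ^ 2) ^ (2 * N) = (r ^ 2) ^ N * (r ^ 2) ^ N := by rw [two_mul, pow_add]
      simp only [pow_succ ((r ^ 2) : ℂ) (2 * N), pow_succ ((r ^ 2) : ℂ) N, hP]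
      generalize (r ^ 2) ^ n = X at *
      generalize (r ^ 2) ^ N = P at *
      generalize r ^ 2 = p at *
      field_simp
      ring

/-! ### Convergence of the products, and continuity of theta at `p = 0`. -/

lemma summable_base_pow {p : ℂ} (hp : ‖p‖ < 1) : Summable fun j : ℕ => ‖-(p * p ^ j)‖ := by
  simp only [norm_neg, norm_mul, norm_pow]
  exact (summable_geometric_of_lt_one (norm_nonneg _) hp).mul_left _

/-- The limit `(p;p)_∞` of `(p;p)_n` is nonzero. -/
lemma exists_tendsto_basicPoch_self {p : ℂ} (hp : ‖p‖ < 1) :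
    ∃ C : ℂ, C ≠ 0 ∧ Tendsto (fun n => basicPoch p p n) atTop (𝓝 C) := by
  refine ⟨∏' j : ℕ, (1 + -(p * p ^ j)), tprod_one_add_ne_zero_of_summable (fun i => ?_)
    (summable_base_pow hp), ?_⟩
  · simpa [sub_eq_add_neg] using one_sub_pow_ne_zero hp i
  · simpa [basicPoch, sub_eq_add_neg] using
      (multipliable_one_add_of_summable (summable_base_pow hp)).hasProd.tendsto_prod_nat

lemma theta_factor (z p : ℂ) (j : ℕ) : (1 - z * p ^ j) * (1 - p ^ (j + 1) / z) =
    1 + (-(z * p ^ j) - p ^ (j + 1) / z + z * p ^ j * (p ^ (j + 1) / z)) := by ring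

/-- The bound is uniform in `‖p‖ ≤ ρ`: `ρ = ‖p‖` gives convergence of the product, and `ρ = 1/2` a
majorant for the limit `p → 0`. -/
lemma norm_theta_factor_le (z : ℂ) {p : ℂ} {ρ : ℝ} (hp : ‖p‖ ≤ ρ) (hρ : ρ ≤ 1) (j : ℕ) :
    ‖-(z * p ^ j) - p ^ (j + 1) / z + z * p ^ j * (p ^ (j + 1) / z)‖ ≤
      (‖z‖ + ‖z‖⁻¹ + ‖z‖ * ‖z‖⁻¹) * ρ ^ j := by
  have h0 : ‖p‖ ^ j ≤ ρ ^ j := pow_le_pow_left₀ (norm_nonneg _) hp j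
  have hp1 : ‖p‖ ≤ 1 := hp.trans hρ
  have h1 : ‖p‖ ^ (j + 1) ≤ ρ ^ j :=
    (pow_le_pow_of_le_one (norm_nonneg _) hp1 j.le_succ).trans h0
  have h2 : ‖p‖ ^ j ≤ 1 := pow_le_one₀ (norm_nonneg _) hp1
  calc _ ≤ ‖z * p ^ j‖ + ‖p ^ (j + 1) / z‖ + ‖z * p ^ j * (p ^ (j + 1) / z)‖ := by
        refine (norm_add_le _ _).trans (add_le_add_left ((norm_sub_le _ _).trans ?_) _)
        rw [norm_neg]
    _ = ‖z‖ * ‖p‖ ^ j + ‖z‖⁻¹ * ‖p‖ ^ (j + 1) + ‖z‖ * ‖z‖⁻¹ * (‖p‖ ^ j * ‖p‖ ^ (j + 1)) := by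
        simp only [norm_mul, norm_div, norm_pow]; ring
    _ ≤ ‖z‖ * ρ ^ j + ‖z‖⁻¹ * ρ ^ j + ‖z‖ * ‖z‖⁻¹ * (1 * ρ ^ j) := by gcongr
    _ = _ := by ring

lemma multipliable_modTheta (z : ℂ) {p : ℂ} (hp : ‖p‖ < 1) :
    Multipliable fun j : ℕ => (1 - z * p ^ j) * (1 - p ^ (j + 1) / z) := by
  simp only [theta_factor]
  refine multipliable_one_add_of_summable (Summable.of_nonneg_of_le (fun _ => norm_nonneg _)
    (fun j => norm_theta_factor_le z le_rfl hp.le j) ?_)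
  exact (summable_geometric_of_lt_one (norm_nonneg _) hp).mul_left _

lemma tendsto_modTheta_zero (z : ℂ) : Tendsto (modTheta z) (𝓝 0) (𝓝 (modTheta z 0)) := by
  unfold modTheta
  simp only [theta_factor]
  refine tendsto_tprod_one_add_of_dominated_convergence
    (bound := fun j => (‖z‖ + ‖z‖⁻¹ + ‖z‖ * ‖z‖⁻¹) * (1 / 2 : ℝ) ^ j)
    (summable_geometric_two.mul_left _) (fun j => ?_) ?_
  · refine Continuous.tendsto (f := fun p : ℂ =>
      -(z * p ^ j) - p ^ (j + 1) / z + z * p ^ j * (p ^ (j + 1) / z)) ?_ 0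
    fun_prop
  · filter_upwards [Metric.closedBall_mem_nhds (0 : ℂ) (by norm_num : (0 : ℝ) < 1 / 2)] with p hp j
    exact norm_theta_factor_le z (by simpa using hp) (by norm_num) j

/-- As `0 ^ 0 = 1`, only the factor `j = 0` differs from `1`. -/
lemma modTheta_base_zero (z : ℂ) : modTheta z 0 = 1 - z := by
  rw [modTheta, tprod_eq_mulSingle 0 fun j hj => by simp [hj]]
  simp

/-! ### The triple product as the limit of its finite form. -/

lemma exists_bound_invPoch {p : ℂ} (hp : ‖p‖ < 1) : ∃ B : ℝ, 0 ≤ B ∧ ∀ k, ‖invPoch p k‖ ≤ B := by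
  obtain ⟨C, hC, h⟩ := exists_tendsto_basicPoch_self hp
  obtain ⟨B, hB⟩ := (h.inv₀ hC).norm.bddAbove_range
  have h0 (n : ℕ) : ‖(basicPoch p p n)⁻¹‖ ≤ B := hB ⟨n, rfl⟩
  refine ⟨B, (norm_nonneg _).trans (h0 0), fun k => ?_⟩
  rw [invPoch]
  split_ifs
  · simpa using (norm_nonneg _).trans (h0 0)
  · exact h0 _

/-- The Jacobi triple product identity. -/
lemma exists_triple_product {r : ℂ} (hr : r ≠ 0) (hr1 : ‖r‖ < 1) :
    ∃ C : ℂ, C ≠ 0 ∧ ∀ z : ℂ, z ≠ 0 → C * modTheta z (r ^ 2) = ∑' n : ℤ, thetaTerm r z n := by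
  have hp := norm_sq_lt_one hr1
  obtain ⟨C, hC, h⟩ := exists_tendsto_basicPoch_self hp
  obtain ⟨B, hB0, hB⟩ := exists_bound_invPoch hp
  obtain ⟨D, hD⟩ := h.norm.bddAbove_range
  have hD' (n : ℕ) : ‖basicPoch (r ^ 2) (r ^ 2) n‖ ≤ D := hD ⟨n, rfl⟩
  have hinv (n : ℤ) : Tendsto (fun N : ℕ => invPoch (r ^ 2) (N + n)) atTop (𝓝 C⁻¹) := by
    have hn : Tendsto (fun N : ℕ => ((N : ℤ) + n).toNat) atTop atTop :=
      tendsto_atTop.2 fun b => by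
        filter_upwards [eventually_ge_atTop (b + n.natAbs)] with N hN
        omega
    refine ((h.comp hn).inv₀ hC).congr' ?_
    filter_upwards [eventually_ge_atTop n.natAbs] with N hN
    rw [invPoch, if_neg (by omega)]
    rfl
  refine ⟨C, hC, fun z hz => ?_⟩
  -- Each `q`-binomial coefficient tends to `C * C⁻¹ * C⁻¹`, and the bounds `D`, `B` on `(p;p)_n`
  -- and its reciprocals give a majorant independent of `N`.
  have hlim : Tendsto (fun N : ℕ => ∑' n : ℤ, basicPoch (r ^ 2) (r ^ 2) (2 * N) *
      invPoch (r ^ 2) (N - n) * invPoch (r ^ 2) (N + n) * thetaTerm r z n) atTop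
      (𝓝 (∑' n : ℤ, C * C⁻¹ * C⁻¹ * thetaTerm r z n)) := by
    refine tendsto_tsum_of_dominated_convergence (bound := fun n => D * B * B * ‖thetaTerm r z n‖)
      ((summable_thetaTerm hr hz hr1).norm.mul_left _) (fun n => ?_)
      (Eventually.of_forall fun N n => ?_)
    · refine Tendsto.mul_const _ (Tendsto.mul (Tendsto.mul ?_ ?_) (hinv n))
      · exact h.comp (tendsto_id.const_mul_atTop' two_pos)
      · simpa [sub_eq_add_neg] using hinv (-n)
    · simp only [norm_mul]
      have hD0 : 0 ≤ D := (norm_nonneg _).trans (hD' 0)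
      gcongr
      · exact hD' _
      · exact hB _
      · exact hB _
  have hprod := (multipliable_modTheta z hp).hasProd.tendsto_prod_nat
  simp only [(hasSum_finite_triple_product hr hz hr1 _).tsum_eq] at hlim
  have := tendsto_nhds_unique hprod hlim
  rw [modTheta, this, tsum_mul_left, mul_inv_cancel₀ hC, one_mul, mul_inv_cancel_left₀ hC]

/-! ### The addition formula and the reflection of theta. -/

lemma parity_bijective : Function.Bijective (Sum.elim (fun i : ℤ × ℤ => (i.1 + i.2, i.1 - i.2))
    (fun i : ℤ × ℤ => (i.1 + i.2, i.1 - i.2 + 1))) := by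
  constructor
  · rintro (⟨i, j⟩ | ⟨i, j⟩) (⟨i', j'⟩ | ⟨i', j'⟩) h <;>
      simp only [Sum.elim_inl, Sum.elim_inr, Prod.mk.injEq] at h
    · rw [show i = i' by omega, show j = j' by omega]
    · omega
    · omega
    · rw [show i = i' by omega, show j = j' by omega]
  · rintro ⟨m, n⟩
    rcases Int.emod_two_eq_zero_or_one (m + n) with h | h
    · refine ⟨Sum.inl ((m + n) / 2, m - (m + n) / 2), ?_⟩
      simp only [Sum.elim_inl, Prod.mk.injEq]
      omega
    · refine ⟨Sum.inr ((m + n) / 2, m - (m + n) / 2), ?_⟩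
      simp only [Sum.elim_inr, Prod.mk.injEq]
      omega

/-- In `(i+j)² + (i-j)²` the cross terms cancel, so the variables separate into two theta series
whose nome is the square of the original one. This is the half of the double series with even index
sum. -/
lemma thetaTerm_mul_even {r x y : ℂ} (hr : r ≠ 0) (hx : x ≠ 0) (hy : y ≠ 0) (i j : ℤ) :
    thetaTerm r (x * y) (i + j) * thetaTerm r (x / y) (i - j) =
      thetaTerm (r ^ 2) (-x ^ 2) i * thetaTerm (r ^ 2) (-(r * y) ^ 2) j := by
  have h1 : (-1 : ℂ) ≠ 0 := by norm_num
  have key : thetaTerm r (x * y) (i + j) * thetaTerm r (x / y) (i - j) =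
      ((-1) ^ i * (-1) ^ i) * r ^ (2 * (i ^ 2 - i) + 2 * (j ^ 2 - j) + 2 * j) *
        (x ^ (2 * i) * y ^ (2 * j)) := by
    have e1 : ((-1 : ℂ)) ^ i * (-1) ^ i = (-1) ^ (i + j) * (-1) ^ (i - j) := by
      rw [← zpow_add₀ h1, ← zpow_add₀ h1]; congr 1; ring
    have e2 : x ^ (2 * i) = x ^ (i + j) * x ^ (i - j) := by
      rw [← zpow_add₀ hx]; congr 1; ring
    have e3 : y ^ (2 * j) = y ^ (i + j) / y ^ (i - j) := by
      rw [← zpow_sub₀ hy]; congr 1; ring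
    have e4 : r ^ (2 * (i ^ 2 - i) + 2 * (j ^ 2 - j) + 2 * j) =
        r ^ ((i + j) ^ 2 - (i + j)) * r ^ ((i - j) ^ 2 - (i - j)) := by
      rw [← zpow_add₀ hr]; congr 1; ring
    rw [e1, e2, e3, e4]
    simp only [thetaTerm, mul_zpow, div_zpow]
    ring
  have hsq : ∀ (w : ℂ) (n : ℤ), (w ^ 2) ^ n = w ^ (2 * n) := fun w n => by
    rw [zpow_mul, zpow_ofNat]
  have hneg : ∀ (w : ℂ) (n : ℤ), (-w ^ 2) ^ n = (-1) ^ n * w ^ (2 * n) := fun w n => by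
    rw [neg_eq_neg_one_mul, mul_zpow, hsq]
  rw [key]
  simp only [thetaTerm, hneg, hsq, mul_zpow, zpow_add₀ hr]
  have hj : ((-1 : ℂ)) ^ j * (-1) ^ j = 1 := by
    rw [← mul_zpow]; norm_num
  linear_combination (-(-1) ^ i * (-1) ^ i * r ^ (2 * (i ^ 2 - i)) * r ^ (2 * (j ^ 2 - j)) *
    r ^ (2 * j) * x ^ (2 * i) * y ^ (2 * j)) * hj

/-- The reflection `n ↦ 1 - n` of the second factor reduces this to the even case with `x` and `y`
exchanged. -/
lemma thetaTerm_mul_odd {r x y : ℂ} (hr : r ≠ 0) (hx : x ≠ 0) (hy : y ≠ 0) (i j : ℤ) :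
    thetaTerm r (x * y) (i + j) * thetaTerm r (x / y) (i - j + 1) =
      -(x / y) * (thetaTerm (r ^ 2) (-(r * x) ^ 2) i * thetaTerm (r ^ 2) (-y ^ 2) j) := by
  have h := thetaTerm_mul_even hr hy hx j i
  have h0 : thetaTerm r (x / y) (i - j + 1) = -(x / y) * thetaTerm r (y / x) (j - i) := by
    have h1 : (-1 : ℂ) ≠ 0 := by norm_num
    have h2 : ((-1 : ℂ)) ^ (i - j) = (-1) ^ (j - i) := by
      rw [show j - i = -(i - j) by ring, zpow_neg, ← inv_zpow]; norm_num
    rw [thetaTerm, thetaTerm, show (i - j + 1) ^ 2 - (i - j + 1) = (j - i) ^ 2 - (j - i) by ring,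
      zpow_add₀ h1, h2, zpow_add₀ (div_ne_zero hx hy), show i - j = -(j - i) by ring, zpow_neg,
      ← inv_zpow, inv_div]
    simp only [zpow_one]
    ring
  rw [h0, mul_comm (thetaTerm (r ^ 2) (-(r * x) ^ 2) i), ← h, add_comm i j, mul_comm x y]
  ring

/-- The theta product as a `2 × 2` determinant. -/
lemma exists_modTheta_mul_modTheta {p : ℂ} (hp0 : p ≠ 0) (hp : ‖p‖ < 1) :
    ∃ (C : ℂ) (f g : ℂ → ℂ), C ≠ 0 ∧ ∀ x y : ℂ, x ≠ 0 → y ≠ 0 →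
      C * (modTheta (x * y) p * modTheta (x / y) p) = x * (f x * g y - g x * f y) := by
  obtain ⟨r, rfl⟩ : ∃ r : ℂ, r ^ 2 = p := IsAlgClosed.exists_pow_nat_eq p two_pos
  have hr : r ≠ 0 := by rintro rfl; simp at hp0
  have hr1 : ‖r‖ < 1 := by
    rw [norm_pow] at hp; exact (pow_lt_one_iff_of_nonneg (norm_nonneg _) two_ne_zero).1 hp
  obtain ⟨C, hC, h⟩ := exists_triple_product hr hr1
  set ψ : ℂ → ℂ := fun x => ∑' n : ℤ, thetaTerm (r ^ 2) (-x ^ 2) n with hψ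
  -- The even half is `ψ(x)ψ(ry)` and the odd half `-(x/y)ψ(rx)ψ(y)`; taking out `x` leaves the
  -- determinant of `f = ψ(x)/x` and `g = ψ(rx)`.
  refine ⟨C ^ 2, fun x => ψ x / x, fun x => ψ (r * x), pow_ne_zero _ hC, fun x y hx hy => ?_⟩
  have sm : ∀ w : ℂ, w ≠ 0 → Summable fun n => ‖thetaTerm (r ^ 2) (-w ^ 2) n‖ := fun w hw =>
    (summable_thetaTerm (pow_ne_zero _ hr) (neg_ne_zero.2 (pow_ne_zero _ hw)) hp).norm
  have hxy := mul_ne_zero hx hy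
  have hxdy := div_ne_zero hx hy
  have s1 := (summable_thetaTerm hr hxy hr1).norm
  have s2 := (summable_thetaTerm hr hxdy hr1).norm
  have hF := summable_mul_of_summable_norm s1 s2
  have hs := (Equiv.ofBijective _ parity_bijective).summable_iff.2 hF
  have heven : ∑' i : ℤ × ℤ, thetaTerm r (x * y) (i.1 + i.2) * thetaTerm r (x / y) (i.1 - i.2) =
      ψ x * ψ (r * y) := by
    simp only [thetaTerm_mul_even hr hx hy, hψ]
    exact (tsum_mul_tsum_of_summable_norm (sm x hx) (sm (r * y) (mul_ne_zero hr hy))).symm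
  have hodd : ∑' i : ℤ × ℤ, thetaTerm r (x * y) (i.1 + i.2) * thetaTerm r (x / y) (i.1 - i.2 + 1) =
      -(x / y) * (ψ (r * x) * ψ y) := by
    simp only [thetaTerm_mul_odd hr hx hy, hψ, tsum_mul_left]
    rw [tsum_mul_tsum_of_summable_norm (sm (r * x) (mul_ne_zero hr hx)) (sm y hy)]
  calc C ^ 2 * (modTheta (x * y) (r ^ 2) * modTheta (x / y) (r ^ 2))
      = (C * modTheta (x * y) (r ^ 2)) * (C * modTheta (x / y) (r ^ 2)) := by ring
    _ = ψ x * ψ (r * y) + -(x / y) * (ψ (r * x) * ψ y) := by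
      rw [h _ hxy, h _ hxdy, tsum_mul_tsum_of_summable_norm s1 s2,
        ← (Equiv.ofBijective _ parity_bijective).tsum_eq, ← heven, ← hodd]
      exact Summable.tsum_sum (hs.comp_injective Sum.inl_injective)
        (hs.comp_injective Sum.inr_injective)
    _ = _ := by
      field_simp
      ring

/-- The addition formula for the theta function. -/
lemma modTheta_addition {p : ℂ} (hp : ‖p‖ < 1) {x y u v : ℂ} (hx : x ≠ 0) (hy : y ≠ 0)
    (hu : u ≠ 0) (hv : v ≠ 0) :
    modTheta (x * y) p * modTheta (x / y) p * (modTheta (u * v) p * modTheta (u / v) p) -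
      modTheta (x * v) p * modTheta (x / v) p * (modTheta (u * y) p * modTheta (u / y) p) =
    u / y * (modTheta (x * u) p * modTheta (x / u) p * (modTheta (y * v) p * modTheta (y / v) p))
      := by
  rcases eq_or_ne p 0 with rfl | hp0
  · simp only [modTheta_base_zero]
    field_simp
    ring
  -- Every pair of thetas is a minor of the vectors `(f, g)` at `x, y, u, v`. What remains is the
  -- Plücker relation for four vectors in the plane; the prefactors of the minors account for `u /
  -- y`.
  · obtain ⟨C, f, g, hC, h⟩ := exists_modTheta_mul_modTheta hp0 hp
    refine mul_left_cancel₀ (pow_ne_zero 2 hC) ?_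
    have h1 := h x y hx hy
    have h2 := h u v hu hv
    have h3 := h x v hx hv
    have h4 := h u y hu hy
    have h5 := h x u hx hu
    have h6 := h y v hy hv
    calc _ = (C * (modTheta (x * y) p * modTheta (x / y) p)) *
          (C * (modTheta (u * v) p * modTheta (u / v) p)) -
          (C * (modTheta (x * v) p * modTheta (x / v) p)) *
          (C * (modTheta (u * y) p * modTheta (u / y) p)) := by ring
      _ = u / y * ((C * (modTheta (x * u) p * modTheta (x / u) p)) *
          (C * (modTheta (y * v) p * modTheta (y / v) p))) := by
        rw [h1, h2, h3, h4, h5, h6]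
        field_simp
        ring
      _ = _ := by ring

lemma exists_sq_eq (z : ℂ) : ∃ s : ℂ, s ^ 2 = z := IsAlgClosed.exists_pow_nat_eq z two_pos

/-- For `p ≠ 0` this is the reflection `n ↦ 1 - n` of the theta series. -/
lemma modTheta_inv {p z : ℂ} (hp : ‖p‖ < 1) (hz : z ≠ 0) :
    modTheta z⁻¹ p = -modTheta z p / z := by
  rcases eq_or_ne p 0 with rfl | hp0
  · simp only [modTheta_base_zero]
    field_simp
    ring
  · obtain ⟨r, rfl⟩ := exists_sq_eq p
    have hr : r ≠ 0 := by rintro rfl; simp at hp0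
    have hr1 : ‖r‖ < 1 := by
      rw [norm_pow] at hp; exact (pow_lt_one_iff_of_nonneg (norm_nonneg _) two_ne_zero).1 hp
    obtain ⟨C, hC, h⟩ := exists_triple_product hr hr1
    refine mul_left_cancel₀ hC ?_
    rw [h _ (inv_ne_zero hz), ← (Equiv.subLeft (1 : ℤ)).tsum_eq]
    rw [mul_div_assoc', mul_neg, h _ hz, neg_div, ← tsum_div_const, ← tsum_neg]
    congr 1
    funext n
    have h1 : (-1 : ℂ) ≠ 0 := by norm_num
    simp only [Equiv.subLeft_apply, thetaTerm]
    rw [show (1 - n) ^ 2 - (1 - n) = n ^ 2 - n by ring, zpow_sub₀ h1, zpow_sub₀ (inv_ne_zero hz)]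
    have h3 : (((-1 : ℂ)) ^ n)⁻¹ = (-1) ^ n := by rw [← inv_zpow]; norm_num
    simp only [zpow_one, div_eq_mul_inv, h3, inv_zpow, inv_inv]
    ring

/-- The addition formula with its arguments up to propositional equality. -/
lemma modTheta_addition_of_eq {p : ℂ} (hp : ‖p‖ < 1) {x y u v : ℂ} (hx : x ≠ 0) (hy : y ≠ 0)
    (hu : u ≠ 0) (hv : v ≠ 0) {A₁ A₂ A₃ A₄ B₁ B₂ B₃ B₄ C₁ C₂ C₃ C₄ c : ℂ}
    (hA₁ : A₁ = x * y) (hA₂ : A₂ = x / y) (hA₃ : A₃ = u * v) (hA₄ : A₄ = u / v)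
    (hB₁ : B₁ = x * v) (hB₂ : B₂ = x / v) (hB₃ : B₃ = u * y) (hB₄ : B₄ = u / y)
    (hC₁ : C₁ = x * u) (hC₂ : C₂ = x / u) (hC₃ : C₃ = y * v) (hC₄ : C₄ = y / v)
    (hc : c = u / y) :
    modTheta A₁ p * modTheta A₂ p * (modTheta A₃ p * modTheta A₄ p) -
      modTheta B₁ p * modTheta B₂ p * (modTheta B₃ p * modTheta B₄ p) =
    c * (modTheta C₁ p * modTheta C₂ p * (modTheta C₃ p * modTheta C₄ p)) := by
  subst hA₁ hA₂ hA₃ hA₄ hB₁ hB₂ hB₃ hB₄ hC₁ hC₂ hC₃ hC₄ hc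
  exact modTheta_addition hp hx hy hu hv

/-! ### Elliptic shifted factorials -/

lemma ellPoch_zero (a q p : ℂ) : ellPoch a q p 0 = 1 := Finset.prod_range_zero _

/-- The shifted argument is a separate variable, so each use can pick its normal form, such as `a *
q ^ (2 * n + 1)` in base `q ^ 2`. -/
lemma ellPoch_succ_right {a b q p : ℂ} {n : ℕ} (h : b = a * q ^ n) :
    ellPoch a q p (n + 1) = ellPoch a q p n * modTheta b p := by
  rw [h]; exact Finset.prod_range_succ _ _

lemma ellPoch_add {a b q p : ℂ} {m n : ℕ} (h : b = a * q ^ m) :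
    ellPoch a q p (m + n) = ellPoch a q p m * ellPoch b q p n := by
  rw [ellPoch, Finset.prod_range_add, h]
  simp only [ellPoch, pow_add, mul_assoc]

lemma ellPoch_succ_left {a b q p : ℂ} {n : ℕ} (h : b = a * q) :
    ellPoch a q p (n + 1) = modTheta a p * ellPoch b q p n := by
  rw [add_comm, ellPoch_add (b := b) (by rw [pow_one, h])]
  simp [ellPoch]

lemma ellPoch_two_mul (a q p : ℂ) (n : ℕ) :
    ellPoch a q p (2 * n) = ellPoch a (q ^ 2) p n * ellPoch (a * q) (q ^ 2) p n := by
  induction n with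
  | zero => simp [ellPoch]
  | succ n ih =>
    rw [show 2 * (n + 1) = 2 * n + 1 + 1 by ring, ellPoch_succ_right rfl, ellPoch_succ_right rfl, ih,
      ellPoch_succ_right (a := a) rfl, ellPoch_succ_right (a := a * q) rfl,
      show a * q ^ (2 * n + 1) = a * q * (q ^ 2) ^ n by ring, pow_mul]
    ring

lemma ellPoch_ne_zero {a q p : ℂ} (h : ∀ j : ℕ, modTheta (a * q ^ j) p ≠ 0) (n : ℕ) :
    ellPoch a q p n ≠ 0 :=
  Finset.prod_ne_zero_iff.2 fun j _ => h j

lemma modTheta_shift_ne_zero {a b q p : ℂ} (h : ∀ j : ℕ, modTheta (a * q ^ j) p ≠ 0) (i : ℕ)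
    (hb : b = a * q ^ i) (j : ℕ) : modTheta (b * q ^ j) p ≠ 0 := by
  rw [hb, mul_assoc, ← pow_add]; exact h _

lemma ellPoch_shift_ne_zero {a b q p : ℂ} (h : ∀ j : ℕ, modTheta (a * q ^ j) p ≠ 0) (i : ℕ)
    (hb : b = a * q ^ i) (n : ℕ) : ellPoch b q p n ≠ 0 :=
  ellPoch_ne_zero (modTheta_shift_ne_zero h i hb) n

lemma ellPoch_sq_shift_ne_zero {a b q p : ℂ} (h : ∀ j : ℕ, modTheta (a * q ^ j) p ≠ 0) (i : ℕ)
    (hb : b = a * q ^ i) (n : ℕ) : ellPoch b (q ^ 2) p n ≠ 0 :=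
  ellPoch_ne_zero (fun j => by
    rw [← pow_mul]; exact modTheta_shift_ne_zero h i hb _) n

lemma modTheta_ne_zero_of_eq {a b q p : ℂ} (h : ∀ j : ℕ, modTheta (a * q ^ j) p ≠ 0) (i : ℕ)
    (hb : b = a * q ^ i) : modTheta b p ≠ 0 := by
  rw [hb]; exact h i

/-! ### A quadratic elliptic summation -/

/-- The `r`-th term of the quadratic summation of length `s + 2 r`, with `a m = k ^ 2`. -/
noncomputable def quadTerm (q p a k m : ℂ) (s r : ℕ) : ℂ :=
  ellPoch (m * q) (q ^ 2) p (s + 2 * r) / ellPoch (a * q) (q ^ 2) p (s + 2 * r) *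
    (modTheta (m * q ^ (4 * r)) p / modTheta m p *
      (ellPoch (a / k) q p s / ellPoch q q p s) *
      (ellPoch k q p (s + 4 * r) / ellPoch (m * q) q p (s + 4 * r)) * (-(k / a)) ^ s *
      (ellPoch (m / a) (q ^ 2) p r / ellPoch (q ^ 2) (q ^ 2) p r *
        (ellPoch m (q ^ 2) p r / ellPoch (a * q ^ 2) (q ^ 2) p r)))

/-- The coefficient of the previous sum in the recursion for the quadratic summation. -/
noncomputable def quadCoeff₁ (q p a k m : ℂ) (n : ℕ) : ℂ :=
  modTheta (m * q ^ (2 * n + 1)) p / modTheta (a * q ^ (2 * n + 1)) p *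
    (modTheta (a / k * q ^ n) p * modTheta (k * q ^ n) p /
      (modTheta (q ^ (n + 1)) p * modTheta (m * q ^ (n + 1)) p)) * (-(k / a))

/-- The coefficient of the shifted sum in the recursion for the quadratic summation. -/
noncomputable def quadCoeff₂ (q p a k m : ℂ) (n : ℕ) : ℂ :=
  modTheta k p * modTheta (k * q) p * modTheta (k * q ^ 2) p * modTheta (k * q ^ (2 * n + 1)) p *
      modTheta (m / a) p /
    (modTheta (q ^ (n + 1)) p * modTheta (a * q) p * modTheta (a * q ^ 2) p *
      modTheta (a * q ^ (2 * n + 1)) p * modTheta (m * q ^ (n + 1)) p)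

/-- The right-hand side of the quadratic summation. -/
noncomputable def quadValue (q p a k : ℂ) (n : ℕ) : ℂ :=
  ellPoch (k / a) q p n / ellPoch q q p n * (ellPoch k q p n / ellPoch (a * q) q p n)

/-- The denominators of the quadratic summation do not vanish. -/
structure QuadRegular (q p a k m : ℂ) : Prop where
  hq : ∀ j : ℕ, modTheta (q * q ^ j) p ≠ 0
  ha : ∀ j : ℕ, modTheta (a * q ^ j) p ≠ 0
  hk : ∀ j : ℕ, modTheta (k * q ^ j) p ≠ 0
  hm : ∀ j : ℕ, modTheta (m * q ^ j) p ≠ 0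

section

variable {q p a k m : ℂ}

/-- Lower boundary of the recursion: the shifted sum has no counterpart of the term `r = 0`. -/
lemma quadTerm_succ_zero (hk0 : k ≠ 0) (h : QuadRegular q p a k m) (s : ℕ) :
    quadTerm q p a k m (s + 1) 0 = quadCoeff₁ q p a k m s * quadTerm q p a k m s 0 := by
  simp only [quadTerm, quadCoeff₁, mul_zero, add_zero, ellPoch_zero, pow_zero, mul_one]
  rw [ellPoch_succ_right (a := m * q) (q := q ^ 2) (b := m * q ^ (2 * s + 1)) (by ring),
    ellPoch_succ_right (a := a * q) (q := q ^ 2) (b := a * q ^ (2 * s + 1)) (by ring),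
    ellPoch_succ_right (a := a / k) rfl, ellPoch_succ_right (a := k) rfl,
    ellPoch_succ_right (a := q) (b := q ^ (s + 1)) (by ring),
    ellPoch_succ_right (a := m * q) (q := q) (b := m * q ^ (s + 1)) (by ring), pow_succ (-(k / a))]
  obtain ⟨hq, ha, -, hm⟩ := h
  have h1 := ellPoch_sq_shift_ne_zero ha 1 (by rw [pow_one]) s
  have h2 := modTheta_ne_zero_of_eq ha (2 * s + 1) rfl
  have h3 := modTheta_ne_zero_of_eq hq s (b := q ^ (s + 1)) (by ring)
  have h4 := ellPoch_ne_zero hq s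
  have h5 := ellPoch_shift_ne_zero hm 1 (by rw [pow_one]) s
  have h6 := modTheta_ne_zero_of_eq hm (s + 1) rfl
  have h7 := modTheta_ne_zero_of_eq hm 0 (b := m) (by ring)
  field_simp

/-- The addition formula needed for the recursion of the summands. A square root `w` of `m`
suffices, since `a = (k/w)²` is then a square as well. -/
lemma modTheta_quad_identity (hp : ‖p‖ < 1) (hk0 : k ≠ 0) (hq0 : q ≠ 0)
    (hm0 : m ≠ 0) (ham : a * m = k ^ 2) (s t : ℕ) :
    modTheta (k * q ^ (s + 4 * t + 4)) p * modTheta (a / k * q ^ s) p *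
        (modTheta (m * q ^ (s + 2 * t + 3)) p * modTheta (q ^ (s + 2 * t + 3)) p) -
      modTheta (k * q ^ (s + 2 * t + 2)) p * modTheta (a / k * q ^ (s + 2 * t + 2)) p *
        (modTheta (m * q ^ (s + 4 * t + 5)) p * modTheta (q ^ (s + 1)) p) =
    q ^ (s + 1) * (modTheta (k * q ^ (2 * s + 4 * t + 5)) p * modTheta (a / (k * q)) p *
      (modTheta (m * q ^ (2 * t + 2)) p * modTheta (q ^ (2 * t + 2)) p)) := by
  obtain ⟨w, rfl⟩ := exists_sq_eq m
  have hw : w ≠ 0 := by rintro rfl; simp at hm0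
  obtain rfl : a = k ^ 2 / w ^ 2 := by field_simp; exact ham
  refine modTheta_addition_of_eq hp (x := k * q ^ (s + 2 * t + 2) / w) (y := w * q ^ (2 * t + 2))
    (u := w * q ^ (s + 2 * t + 3)) (v := w)
    (div_ne_zero (mul_ne_zero hk0 (pow_ne_zero _ hq0)) hw) (mul_ne_zero hw (pow_ne_zero _ hq0))
    (mul_ne_zero hw (pow_ne_zero _ hq0)) hw ?_ ?_ ?_ ?_ ?_ ?_ ?_ ?_ ?_ ?_ ?_ ?_ ?_ <;>
  · field_simp
    try ring

/-- The addition formula needed for the closed form. Its parameters involve a square root `s` of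
`q^n`, and one theta appears at the reciprocal argument, which produces the sign on the right. -/
lemma modTheta_quadValue_identity (hp : ‖p‖ < 1) (ha0 : a ≠ 0) (hk0 : k ≠ 0) (hq0 : q ≠ 0)
    (ham : a * m = k ^ 2) (n : ℕ) :
    modTheta (k / a * q ^ n) p * modTheta (k / a) p *
        (modTheta (a * q ^ (2 * n + 1)) p * modTheta (m * q ^ (n + 1)) p) -
      modTheta (q ^ n) p * modTheta (m / a) p *
        (modTheta (k * q ^ (2 * n + 1)) p * modTheta (k * q ^ (n + 1)) p) =
    -(k / a) * (modTheta (m * q ^ (2 * n + 1)) p * modTheta (a * q ^ (n + 1)) p *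
      (modTheta (a / k * q ^ n) p * modTheta (k / a) p)) := by
  obtain ⟨s, hs⟩ := exists_sq_eq (q ^ n)
  have hs0 : s ≠ 0 := by
    rintro rfl
    exact pow_ne_zero n hq0 (by rw [← hs]; ring)
  obtain rfl : m = k ^ 2 / a := by field_simp; linear_combination ham
  have hq2 : q ^ (2 * n + 1) = s ^ 4 * q := by
    rw [show s ^ 4 = (s ^ 2) ^ 2 by ring, hs]; ring
  have hq1 : q ^ (n + 1) = s ^ 2 * q := by rw [hs]; ring
  have hinv := modTheta_inv hp (z := a * q ^ (n + 1)) (mul_ne_zero ha0 (pow_ne_zero _ hq0))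
  rw [hq2, hq1, ← hs] at *
  have key := modTheta_addition_of_eq hp (x := k / a * s) (y := s) (u := k * q * s ^ 3)
    (v := a / k * s) (A₁ := k / a * s ^ 2) (A₂ := k / a) (A₃ := a * (s ^ 4 * q))
    (A₄ := k ^ 2 / a * (s ^ 2 * q)) (B₁ := s ^ 2) (B₂ := k ^ 2 / a / a) (B₃ := k * (s ^ 4 * q))
    (B₄ := k * (s ^ 2 * q)) (C₁ := k ^ 2 / a * (s ^ 4 * q)) (C₂ := (a * (s ^ 2 * q))⁻¹)
    (C₃ := a / k * s ^ 2) (C₄ := k / a) (c := k * (s ^ 2 * q))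
    (by positivity) hs0 (by positivity) (by positivity)
    (by field_simp) (by field_simp) (by field_simp) (by field_simp) (by field_simp) (by field_simp)
    (by field_simp) (by field_simp) (by field_simp) (by field_simp) (by field_simp) (by field_simp)
    (by field_simp)
  rw [key, hinv]
  field_simp

/-- The rational function identity behind the recursion for `quadTerm`. -/
lemma quadTerm_quotient_identity
    {X1 X2 X3 X4 Y1 Y2 Y3 Y4 Z1 Z2 Z3 Z4 c d e m0 m1 m2 m3 m4 k0 k1 k2 M A R v a1 a2 P1 P2 P3 P4 P5
      P6 P7 P8 P9 P10 : ℂ}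
    (key : X1 * X2 * (X3 * X4) - Y1 * Y2 * (Y3 * Y4) = c * (Z1 * Z2 * (Z3 * Z4)))
    (n1 : m0 ≠ 0) (n2 : m1 ≠ 0) (n3 : m2 ≠ 0) (n4 : m3 ≠ 0) (n5 : m4 ≠ 0) (n6 : M ≠ 0)
    (n7 : Y3 ≠ 0) (n8 : Z3 ≠ 0) (n9 : X3 ≠ 0) (n10 : Y4 ≠ 0) (n11 : Z4 ≠ 0) (n12 : X4 ≠ 0)
    (n13 : a1 ≠ 0) (n14 : a2 ≠ 0) (n15 : A ≠ 0) (n16 : P2 ≠ 0) (n17 : P10 ≠ 0) (n18 : P4 ≠ 0)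
    (n20 : P8 ≠ 0) (n21 : P6 ≠ 0) :
  m1 * (m3 * P1) / M * M / (a1 * P2 * A) *
    (R / m0 * (P3 * X2 / (P4 * Y4)) * (k0 * (k1 * (k2 * P5)) * X1 / (m1 * (m2 * (m3 * (m4 * P6))) / Y3 * Y3)) *
     (d * e) * (v * P7 / (P8 * Z4) * (m0 * (m2 * P9) / Z3 / (a2 * P10)))) =
  M / A * (Y2 * Y1 / (X4 * X3)) * e * (m1 * (m3 * P1) / M / (a1 * P2) *
    (R / m0 * (P3 / P4) * (k0 * (k1 * (k2 * P5)) / (m1 * (m2 * (m3 * (m4 * P6))) / Y3)) * d *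
     (v * P7 / (P8 * Z4) * (m0 * (m2 * P9) / Z3 / (a2 * P10))))) +
  k0 * k1 * k2 * Z1 * v / (X4 * a1 * a2 * A * X3) *
    (P1 / P2 * (R / m4 * (Z2 * P3 / (P4 * Y4)) * (P5 / P6) * (d * e * c) * (P7 / P8 * (P9 / P10)))) := by
  have hL : m1 * (m3 * P1) / M * M / (a1 * P2 * A) *
      (R / m0 * (P3 * X2 / (P4 * Y4)) *
        (k0 * (k1 * (k2 * P5)) * X1 / (m1 * (m2 * (m3 * (m4 * P6))) / Y3 * Y3)) *
        (d * e) * (v * P7 / (P8 * Z4) * (m0 * (m2 * P9) / Z3 / (a2 * P10)))) =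
      k0 * k1 * k2 * P1 * P3 * P5 * P7 * P9 * R * v * d * e /
        (a1 * a2 * A * P2 * P4 * P6 * P8 * P10 * m4 * X3 * X4 * Y4 * Z3 * Z4) *
      (X1 * X2 * (X3 * X4)) := by
    simp only [div_div, mul_div_assoc', div_mul_eq_mul_div, div_div_eq_mul_div]
    rw [div_eq_div_iff (by repeat' (first | assumption | apply mul_ne_zero))
      (by repeat' (first | assumption | apply mul_ne_zero))]
    ring
  have h1 : M / A * (Y2 * Y1 / (X4 * X3)) * e * (m1 * (m3 * P1) / M / (a1 * P2) *
      (R / m0 * (P3 / P4) *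
        (k0 * (k1 * (k2 * P5)) / (m1 * (m2 * (m3 * (m4 * P6))) / Y3)) * d *
        (v * P7 / (P8 * Z4) * (m0 * (m2 * P9) / Z3 / (a2 * P10))))) =
      k0 * k1 * k2 * P1 * P3 * P5 * P7 * P9 * R * v * d * e /
        (a1 * a2 * A * P2 * P4 * P6 * P8 * P10 * m4 * X3 * X4 * Y4 * Z3 * Z4) *
      (Y1 * Y2 * (Y3 * Y4)) := by
    simp only [div_div, mul_div_assoc', div_mul_eq_mul_div, div_div_eq_mul_div]
    rw [div_eq_div_iff (by repeat' (first | assumption | apply mul_ne_zero))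
      (by repeat' (first | assumption | apply mul_ne_zero))]
    ring
  have h2 : k0 * k1 * k2 * Z1 * v / (X4 * a1 * a2 * A * X3) *
      (P1 / P2 * (R / m4 * (Z2 * P3 / (P4 * Y4)) * (P5 / P6) * (d * e * c) *
        (P7 / P8 * (P9 / P10)))) =
      k0 * k1 * k2 * P1 * P3 * P5 * P7 * P9 * R * v * d * e /
        (a1 * a2 * A * P2 * P4 * P6 * P8 * P10 * m4 * X3 * X4 * Y4 * Z3 * Z4) *
      (c * (Z1 * Z2 * (Z3 * Z4))) := by
    simp only [div_div, mul_div_assoc', div_mul_eq_mul_div]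
    rw [div_eq_div_iff (by repeat' (first | assumption | apply mul_ne_zero))
      (by repeat' (first | assumption | apply mul_ne_zero))]
    ring
  rw [hL, h1, h2, ← key]
  ring

/-- Interior case of the recursion, with `n = s + 2t + 2`: the lengths are `n + 1`, `n` and `n - 1`.
The shift `(aq²,kq³,mq⁴)` preserves `a m = k²`, and it lowers the index `r` by one. -/
lemma quadTerm_succ_succ (hp : ‖p‖ < 1) (ha0 : a ≠ 0) (hk0 : k ≠ 0) (hq0 : q ≠ 0)
    (hm0 : m ≠ 0) (ham : a * m = k ^ 2) (h : QuadRegular q p a k m) (s t : ℕ) :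
    quadTerm q p a k m (s + 1) (t + 1) =
      quadCoeff₁ q p a k m (s + 2 * t + 2) * quadTerm q p a k m s (t + 1) +
      quadCoeff₂ q p a k m (s + 2 * t + 2) *
        quadTerm q p (a * q ^ 2) (k * q ^ 3) (m * q ^ 4) (s + 1) t := by
  have key := modTheta_quad_identity hp hk0 hq0 hm0 ham s t
  have e1 : ellPoch (m * q) (q ^ 2) p (s + 2 * t + 3) = ellPoch (m * q) (q ^ 2) p (s + 2 * t + 2) *
    modTheta (m * q ^ (2 * s + 4 * t + 5)) p := ellPoch_succ_right (by ring)
  have e2 : ellPoch (m * q) (q ^ 2) p (s + 2 * t + 3) = modTheta (m * q) p *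
      (modTheta (m * q ^ 3) p * ellPoch (m * q ^ 5) (q ^ 2) p (s + 2 * t + 1)) := by
    rw [ellPoch_succ_left (b := m * q ^ 3) (by ring), ellPoch_succ_left (b := m * q ^ 5) (by ring)]
  have e3 : ellPoch (a * q) (q ^ 2) p (s + 2 * t + 3) = ellPoch (a * q) (q ^ 2) p (s + 2 * t + 2) *
    modTheta (a * q ^ (2 * s + 4 * t + 5)) p := ellPoch_succ_right (by ring)
  have e4 : ellPoch (a * q) (q ^ 2) p (s + 2 * t + 2) = modTheta (a * q) p *
      ellPoch (a * q ^ 3) (q ^ 2) p (s + 2 * t + 1) := ellPoch_succ_left (by ring)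
  have e5 : ellPoch (a / k) q p (s + 1) = ellPoch (a / k) q p s * modTheta (a / k * q ^ s) p :=
    ellPoch_succ_right rfl
  have e6 : ellPoch (a * q ^ 2 / (k * q ^ 3)) q p (s + 1) = modTheta (a / (k * q)) p *
      ellPoch (a / k) q p s := by
    rw [show a * q ^ 2 / (k * q ^ 3) = a / (k * q) by field_simp]
    exact ellPoch_succ_left (by field_simp)
  have e7 : ellPoch q q p (s + 1) = ellPoch q q p s * modTheta (q ^ (s + 1)) p :=
    ellPoch_succ_right (by ring)
  have e8 : ellPoch k q p (s + 4 * t + 4) = modTheta k p * (modTheta (k * q) p *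
      (modTheta (k * q ^ 2) p * ellPoch (k * q ^ 3) q p (s + 1 + 4 * t))) := by
    rw [show s + 1 + 4 * t = s + 4 * t + 1 by ring, ellPoch_succ_left rfl,
      ellPoch_succ_left (b := k * q ^ 2) (by ring), ellPoch_succ_left (b := k * q ^ 3) (by ring)]
  have e9 : ellPoch k q p (s + 4 * t + 5) = ellPoch k q p (s + 4 * t + 4) *
    modTheta (k * q ^ (s + 4 * t + 4)) p := ellPoch_succ_right rfl
  have e10 : ellPoch (m * q) q p (s + 4 * t + 5) = ellPoch (m * q) q p (s + 4 * t + 4) *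
    modTheta (m * q ^ (s + 4 * t + 5)) p := ellPoch_succ_right (by ring)
  have e11 : ellPoch (m * q) q p (s + 4 * t + 5) = modTheta (m * q) p * (modTheta (m * q ^ 2) p *
      (modTheta (m * q ^ 3) p * (modTheta (m * q ^ 4) p *
        ellPoch (m * q ^ 5) q p (s + 1 + 4 * t)))) := by
    rw [show s + 1 + 4 * t = s + 4 * t + 1 by ring, ellPoch_succ_left (b := m * q ^ 2) (by ring),
      ellPoch_succ_left (b := m * q ^ 3) (by ring), ellPoch_succ_left (b := m * q ^ 4) (by ring),
      ellPoch_succ_left (b := m * q ^ 5) (by ring)]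
  have e12 : ellPoch (m / a) (q ^ 2) p (t + 1) = modTheta (m / a) p *
      ellPoch (m * q ^ 4 / (a * q ^ 2)) (q ^ 2) p t := ellPoch_succ_left (by field_simp)
  have e13 : ellPoch (q ^ 2) (q ^ 2) p (t + 1) = ellPoch (q ^ 2) (q ^ 2) p t *
    modTheta (q ^ (2 * t + 2)) p := ellPoch_succ_right (by ring)
  have e14 : ellPoch m (q ^ 2) p (t + 1) * modTheta (m * q ^ (2 * t + 2)) p = modTheta m p *
      (modTheta (m * q ^ 2) p * ellPoch (m * q ^ 4) (q ^ 2) p t) := by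
    rw [← ellPoch_succ_right (by ring), ellPoch_succ_left rfl,
      ellPoch_succ_left (b := m * q ^ 4) (by ring)]
  have e15 : ellPoch (a * q ^ 2) (q ^ 2) p (t + 1) = modTheta (a * q ^ 2) p *
      ellPoch (a * q ^ 4) (q ^ 2) p t := ellPoch_succ_left (by ring)
  have n1 := modTheta_ne_zero_of_eq h.hm 0 (b := m) (by ring)
  have n2 := modTheta_ne_zero_of_eq h.hm 1 (b := m * q) (by ring)
  have n3 := h.hm 2
  have n4 := h.hm 3
  have n5 := h.hm 4
  have n6 := h.hm (2 * s + 4 * t + 5)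
  have n7 := h.hm (s + 4 * t + 5)
  have n8 := h.hm (2 * t + 2)
  have n9 := h.hm (s + 2 * t + 3)
  have n10 := modTheta_ne_zero_of_eq h.hq s (b := q ^ (s + 1)) (by ring)
  have n11 := modTheta_ne_zero_of_eq h.hq (2 * t + 1) (b := q ^ (2 * t + 2)) (by ring)
  have n12 := modTheta_ne_zero_of_eq h.hq (s + 2 * t + 2) (b := q ^ (s + 2 * t + 3)) (by ring)
  have n13 := modTheta_ne_zero_of_eq h.ha 1 (b := a * q) (by ring)
  have n14 := h.ha 2
  have n15 := h.ha (2 * s + 4 * t + 5)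
  have n16 := ellPoch_sq_shift_ne_zero h.ha 3 rfl (s + 2 * t + 1)
  have n17 := ellPoch_sq_shift_ne_zero h.ha 4 rfl t
  have n18 := ellPoch_ne_zero h.hq s
  have n20 := ellPoch_sq_shift_ne_zero h.hq 1 (b := q ^ 2) (by ring) t
  have n21 := ellPoch_shift_ne_zero h.hm 5 rfl (s + 1 + 4 * t)
  -- The same factorial has been extended on the right and stripped on the left; comparing the two
  -- expresses the unshifted factorial through the shifted one.
  rw [e1] at e2
  rw [e10] at e11
  have f1 := eq_div_of_mul_eq n6 e2
  have f2 := eq_div_of_mul_eq n7 e11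
  have f3 := eq_div_of_mul_eq n8 e14
  simp only [quadTerm, quadCoeff₁, quadCoeff₂]
  rw [show s + 1 + 2 * (t + 1) = s + 2 * t + 3 by ring, show s + 2 * (t + 1) = s + 2 * t + 2 by ring,
    show s + 1 + 4 * (t + 1) = s + 4 * t + 5 by ring, show s + 4 * (t + 1) = s + 4 * t + 4 by ring,
    show 2 * (s + 2 * t + 2) + 1 = 2 * s + 4 * t + 5 by ring, show s + 1 + 2 * t = s + 2 * t + 1 by ring,
    show s + 2 * t + 2 + 1 = s + 2 * t + 3 by ring,
    show m * q ^ 4 * q ^ (4 * t) = m * q ^ (4 * (t + 1)) by ring,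
    show m * q ^ 4 * q = m * q ^ 5 by ring, show a * q ^ 2 * q = a * q ^ 3 by ring,
    show a * q ^ 2 * q ^ 2 = a * q ^ 4 by ring, show -(k * q ^ 3 / (a * q ^ 2)) = -(k / a) * q by
      field_simp, e10, e1, e3, e4, e5, e6, e7, e9, e8, e12, e13, e15, f1, f2, f3, mul_pow]
  rw [pow_succ (-(k / a))]
  exact quadTerm_quotient_identity key n1 n2 n3 n4 n5 n6 n7 n8 n9 n10 n11 n12 n13 n14 n15 n16 n17
    n18 n20 n21

/-- Upper boundary of the recursion: when `2r` equals the length, the sum shorter by one has no term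
of index `r`. -/
lemma quadTerm_zero_succ (ha0 : a ≠ 0) (hq0 : q ≠ 0) (h : QuadRegular q p a k m) (t : ℕ) :
    quadTerm q p a k m 0 (t + 1) = quadCoeff₂ q p a k m (2 * t + 1) *
        quadTerm q p (a * q ^ 2) (k * q ^ 3) (m * q ^ 4) 0 t := by
  have e2 : ellPoch (m * q) (q ^ 2) p (2 * t + 2) = modTheta (m * q) p *
      (modTheta (m * q ^ 3) p * ellPoch (m * q ^ 5) (q ^ 2) p (2 * t)) := by
    rw [ellPoch_succ_left (b := m * q ^ 3) (by ring), ellPoch_succ_left (b := m * q ^ 5) (by ring)]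
  have e3 : ellPoch (a * q) (q ^ 2) p (2 * t + 2) = modTheta (a * q) p *
      (ellPoch (a * q ^ 3) (q ^ 2) p (2 * t) * modTheta (a * q ^ (4 * t + 3)) p) := by
    rw [ellPoch_succ_left (b := a * q ^ 3) (by ring),
      ellPoch_succ_right (b := a * q ^ (4 * t + 3)) (by ring)]
  have e8 : ellPoch k q p (4 * t + 4) = modTheta k p * (modTheta (k * q) p *
      (modTheta (k * q ^ 2) p * (ellPoch (k * q ^ 3) q p (4 * t) *
        modTheta (k * q ^ (4 * t + 3)) p))) := by
    rw [ellPoch_succ_left rfl, ellPoch_succ_left (b := k * q ^ 2) (by ring),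
      ellPoch_succ_left (b := k * q ^ 3) (by ring),
      ellPoch_succ_right (b := k * q ^ (4 * t + 3)) (by ring)]
  have e11 : ellPoch (m * q) q p (4 * t + 4) = modTheta (m * q) p * (modTheta (m * q ^ 2) p *
      (modTheta (m * q ^ 3) p * (modTheta (m * q ^ 4) p * ellPoch (m * q ^ 5) q p (4 * t)))) := by
    rw [ellPoch_succ_left (b := m * q ^ 2) (by ring),
      ellPoch_succ_left (b := m * q ^ 3) (by ring), ellPoch_succ_left (b := m * q ^ 4) (by ring),
      ellPoch_succ_left (b := m * q ^ 5) (by ring)]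
  have e12 : ellPoch (m / a) (q ^ 2) p (t + 1) = modTheta (m / a) p *
      ellPoch (m * q ^ 4 / (a * q ^ 2)) (q ^ 2) p t := ellPoch_succ_left (by field_simp)
  have e13 : ellPoch (q ^ 2) (q ^ 2) p (t + 1) = ellPoch (q ^ 2) (q ^ 2) p t *
    modTheta (q ^ (2 * t + 2)) p := ellPoch_succ_right (by ring)
  have e14 : ellPoch m (q ^ 2) p (t + 1) * modTheta (m * q ^ (2 * t + 2)) p = modTheta m p *
      (modTheta (m * q ^ 2) p * ellPoch (m * q ^ 4) (q ^ 2) p t) := by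
    rw [← ellPoch_succ_right (by ring), ellPoch_succ_left rfl,
      ellPoch_succ_left (b := m * q ^ 4) (by ring)]
  have e15 : ellPoch (a * q ^ 2) (q ^ 2) p (t + 1) = modTheta (a * q ^ 2) p *
      ellPoch (a * q ^ 4) (q ^ 2) p t := ellPoch_succ_left (by ring)
  have n1 := modTheta_ne_zero_of_eq h.hm 0 (b := m) (by ring)
  have n2 := modTheta_ne_zero_of_eq h.hm 1 (b := m * q) (by ring)
  have n3 := h.hm 2
  have n4 := h.hm 3
  have n5 := h.hm 4
  have n8 := h.hm (2 * t + 2)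
  have n11 := modTheta_ne_zero_of_eq h.hq (2 * t + 1) (b := q ^ (2 * t + 2)) (by ring)
  have n13 := modTheta_ne_zero_of_eq h.ha 1 (b := a * q) (by ring)
  have n14 := h.ha 2
  have n15 := h.ha (4 * t + 3)
  have n16 := ellPoch_sq_shift_ne_zero h.ha 3 rfl (2 * t)
  have n17 := ellPoch_sq_shift_ne_zero h.ha 4 rfl t
  have n20 := ellPoch_sq_shift_ne_zero h.hq 1 (b := q ^ 2) (by ring) t
  have n21 := ellPoch_shift_ne_zero h.hm 5 rfl (4 * t)
  have f3 := eq_div_of_mul_eq n8 e14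
  simp only [quadTerm, quadCoeff₂, ellPoch_zero, pow_zero, mul_one, div_one]
  rw [show 0 + 2 * (t + 1) = 2 * t + 2 by ring, show 0 + 4 * (t + 1) = 4 * t + 4 by ring,
    show 2 * (2 * t + 1) + 1 = 4 * t + 3 by ring, zero_add, zero_add,
    show 2 * t + 1 + 1 = 2 * t + 2 by ring,
    show m * q ^ 4 * q ^ (4 * t) = m * q ^ (4 * (t + 1)) by ring,
    show m * q ^ 4 * q = m * q ^ 5 by ring, show a * q ^ 2 * q = a * q ^ 3 by ring,
    show a * q ^ 2 * q ^ 2 = a * q ^ 4 by ring, e2, e3, e8, e11, e12, e13, e15, f3]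
  simp only [div_div, mul_div_assoc', div_mul_eq_mul_div]
  rw [div_eq_div_iff (by repeat' (first | assumption | apply mul_ne_zero))
    (by repeat' (first | assumption | apply mul_ne_zero))]
  ring

lemma quadValue_one (hp : ‖p‖ < 1) (ha0 : a ≠ 0) (hk0 : k ≠ 0) (h : QuadRegular q p a k m) :
    quadValue q p a k 1 = quadCoeff₁ q p a k m 0 := by
  have n1 := modTheta_ne_zero_of_eq h.hm 1 (b := m * q) (by ring)
  have n2 := modTheta_ne_zero_of_eq h.hq 0 (b := q) (by ring)
  have n3 := modTheta_ne_zero_of_eq h.ha 1 (b := a * q) (by ring)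
  have hinv := modTheta_inv hp (div_ne_zero hk0 ha0)
  rw [inv_div] at hinv
  simp only [quadValue, quadCoeff₁, ellPoch, Finset.prod_range_one, pow_zero, mul_one, zero_add,
    mul_zero, pow_one, hinv]
  generalize modTheta (m * q) p = w at *
  field_simp

/-- The rational function identity behind the recursion for `quadValue`. -/
lemma quadValue_quotient_identity {X1 X2 X3 X4 Y1 Y2 Y3 Y4 Z1 Z3 c k0 k1 k2 P1 P2 P3 P4 K a1 a2 : ℂ}
    (key : X1 * X2 * (X3 * X4) - Y1 * Y2 * (Y3 * Y4) = c * (Z1 * Z3 * (P1 * X2)))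
    (n1 : X3 ≠ 0) (n2 : X4 ≠ 0) (n3 : Y1 ≠ 0) (n4 : Y4 ≠ 0) (n5 : Z3 ≠ 0) (n6 : a1 ≠ 0)
    (n7 : a2 ≠ 0) (n8 : P2 ≠ 0) (n9 : P4 ≠ 0) (n10 : K ≠ 0) (Q : ℂ) (n11 : Q ≠ 0) (L : ℂ) :
    X2 * L * X1 / (P2 * Y1 * Q) * (k0 * (k1 * (k2 * P3)) / Y4 / (a1 * (a2 * P4))) =
      Z1 / X3 * (P1 * K / (Q * X4)) * c *
        (X2 * L / (P2 * Y1) * (k0 * (k1 * (k2 * P3)) / Y4 / K / (a1 * (a2 * P4) / Z3))) +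
      k0 * k1 * k2 * Y3 * Y2 / (Q * a1 * a2 * X3 * X4) * (L / P2 * (P3 / P4)) := by
  have hL : X2 * L * X1 / (P2 * Y1 * Q) * (k0 * (k1 * (k2 * P3)) / Y4 / (a1 * (a2 * P4))) =
      L * k0 * k1 * k2 * P3 / (P2 * Y1 * Q * Y4 * a1 * a2 * P4 * X3 * X4) *
        (X1 * X2 * (X3 * X4)) := by
    field_simp
  have h1 : Z1 / X3 * (P1 * K / (Q * X4)) * c *
      (X2 * L / (P2 * Y1) * (k0 * (k1 * (k2 * P3)) / Y4 / K / (a1 * (a2 * P4) / Z3))) =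
      L * k0 * k1 * k2 * P3 / (P2 * Y1 * Q * Y4 * a1 * a2 * P4 * X3 * X4) *
        (c * (Z1 * Z3 * (P1 * X2))) := by
    field_simp
  have h2 : k0 * k1 * k2 * Y3 * Y2 / (Q * a1 * a2 * X3 * X4) * (L / P2 * (P3 / P4)) =
      L * k0 * k1 * k2 * P3 / (P2 * Y1 * Q * Y4 * a1 * a2 * P4 * X3 * X4) *
        (Y1 * Y2 * (Y3 * Y4)) := by
    field_simp
  rw [hL, h1, h2, ← key]
  ring

/-- The closed form obeys the recursion of the summands, which is what makes the induction close. -/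
lemma quadValue_add_two (hp : ‖p‖ < 1) (ha0 : a ≠ 0) (hk0 : k ≠ 0) (hq0 : q ≠ 0)
    (ham : a * m = k ^ 2) (h : QuadRegular q p a k m) (n : ℕ) :
    quadValue q p a k (n + 2) = quadCoeff₁ q p a k m (n + 1) * quadValue q p a k (n + 1) +
      quadCoeff₂ q p a k m (n + 1) * quadValue q p (a * q ^ 2) (k * q ^ 3) n := by
  have key := modTheta_quadValue_identity hp ha0 hk0 hq0 ham (n + 1)
  have e1 : ellPoch (k / a) q p (n + 1) = modTheta (k / a) p *
      ellPoch (k * q ^ 3 / (a * q ^ 2)) q p n := ellPoch_succ_left (by field_simp)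
  have e2 : ellPoch (k / a) q p (n + 2) = ellPoch (k / a) q p (n + 1) *
      modTheta (k / a * q ^ (n + 1)) p := ellPoch_succ_right rfl
  have e3 : ellPoch q q p (n + 1) = ellPoch q q p n * modTheta (q ^ (n + 1)) p :=
    ellPoch_succ_right (by ring)
  have e4 : ellPoch q q p (n + 2) = ellPoch q q p (n + 1) * modTheta (q ^ (n + 2)) p :=
    ellPoch_succ_right (by ring)
  have e5 : ellPoch k q p (n + 2) = ellPoch k q p (n + 1) * modTheta (k * q ^ (n + 1)) p :=
    ellPoch_succ_right rfl
  have e6 : ellPoch k q p (n + 2) * modTheta (k * q ^ (n + 2)) p = modTheta k p *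
      (modTheta (k * q) p * (modTheta (k * q ^ 2) p * ellPoch (k * q ^ 3) q p n)) := by
    rw [← ellPoch_succ_right (by ring), ellPoch_succ_left rfl,
      ellPoch_succ_left (b := k * q ^ 2) (by ring), ellPoch_succ_left (b := k * q ^ 3) (by ring)]
  have e7 : ellPoch (a * q) q p (n + 2) = modTheta (a * q) p *
      (modTheta (a * q ^ 2) p * ellPoch (a * q ^ 3) q p n) := by
    rw [ellPoch_succ_left (b := a * q ^ 2) (by ring), ellPoch_succ_left (b := a * q ^ 3) (by ring)]
  have e8 : ellPoch (a * q) q p (n + 1) * modTheta (a * q ^ (n + 2)) p =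
      ellPoch (a * q) q p (n + 2) := (ellPoch_succ_right (by ring)).symm
  have n1 := h.ha (2 * n + 3)
  have n2 := h.hm (n + 2)
  have n3 := modTheta_ne_zero_of_eq h.hq n (b := q ^ (n + 1)) (by ring)
  have n4 := h.hk (n + 2)
  have n5 := h.ha (n + 2)
  have n6 := modTheta_ne_zero_of_eq h.ha 1 (b := a * q) (by ring)
  have n7 := h.ha 2
  have n8 := ellPoch_ne_zero h.hq n
  have n9 := ellPoch_shift_ne_zero h.ha 3 rfl n
  have n10 := h.hk (n + 1)
  have n11 := modTheta_ne_zero_of_eq h.hq (n + 1) (b := q ^ (n + 2)) (by ring)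
  have f1 := eq_div_of_mul_eq n4 e6
  have f2 := eq_div_of_mul_eq n10 e5.symm
  have f3 := eq_div_of_mul_eq n5 e8
  rw [show 2 * (n + 1) + 1 = 2 * n + 3 by ring, show n + 1 + 1 = n + 2 by ring] at key
  simp only [quadValue, quadCoeff₁, quadCoeff₂]
  rw [show 2 * (n + 1) + 1 = 2 * n + 3 by ring, show n + 1 + 1 = n + 2 by ring,
    show a * q ^ 2 * q = a * q ^ 3 by ring, f3, f2, f1, e4, e3, e2, e1, e7]
  exact quadValue_quotient_identity key n1 n2 n3 n4 n5 n6 n7 n8 n9 n10 _ n11 _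

lemma QuadRegular.shift (h : QuadRegular q p a k m) :
    QuadRegular q p (a * q ^ 2) (k * q ^ 3) (m * q ^ 4) :=
  ⟨h.hq, modTheta_shift_ne_zero h.ha 2 rfl, modTheta_shift_ne_zero h.hk 3 rfl,
    modTheta_shift_ne_zero h.hm 4 rfl⟩

/-- The quadratic summation, padded by zeros to an arbitrary sufficiently large range. -/
lemma sum_quadTerm_eq (hp : ‖p‖ < 1) (hq0 : q ≠ 0) (n : ℕ) : ∀ {a k m : ℂ}, a ≠ 0 → k ≠ 0 → m ≠ 0 →
    a * m = k ^ 2 → QuadRegular q p a k m → ∀ L : ℕ, n < 2 * L →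
    ∑ r ∈ Finset.range L, (if 2 * r ≤ n then quadTerm q p a k m (n - 2 * r) r else 0) =
      quadValue q p a k n := by
  induction n using Nat.strong_induction_on with
  | _ n ih =>
    -- The parameters stay general because the recursion shifts them. The free range `L` lets sums
    -- of different lengths be matched index by index, and the test `2 * r ≤ n` guards the truncated
    -- subtraction.
    intro a k m ha0 hk0 hm0 ham h L hL
    obtain ⟨L, rfl⟩ : ∃ L', L = L' + 1 := ⟨L - 1, by omega⟩
    match n, ih, hL with
    | 0, _, _ =>
      have n1 := modTheta_ne_zero_of_eq h.hm 0 (b := m) (by ring)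
      rw [Finset.sum_range_succ', Finset.sum_eq_zero fun r _ => by simp]
      simp [quadTerm, quadValue, ellPoch, n1]
    | 1, ih, _ =>
      have h0 := ih 0 one_pos ha0 hk0 hm0 ham h 1 (by norm_num)
      rw [Finset.sum_range_succ', Finset.sum_eq_zero fun r _ => by
        rw [if_neg (by omega)], zero_add, if_pos (by norm_num), mul_zero, Nat.sub_zero,
        quadTerm_succ_zero hk0 h, quadValue_one hp ha0 hk0 h]
      simp only [Finset.sum_range_one, mul_zero, le_refl, if_true, Nat.sub_zero] at h0
      rw [h0]
      simp [quadValue, ellPoch]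
    | n + 2, ih, hL =>
      have h1 := ih (n + 1) (by omega) ha0 hk0 hm0 ham h (L + 1) (by omega)
      have h2 := ih n (by omega) (mul_ne_zero ha0 (pow_ne_zero 2 hq0))
        (mul_ne_zero hk0 (pow_ne_zero 3 hq0)) (mul_ne_zero hm0 (pow_ne_zero 4 hq0))
        (by linear_combination q ^ 6 * ham) h.shift L (by omega)
      rw [quadValue_add_two hp ha0 hk0 hq0 ham h, ← h1, ← h2, Finset.sum_range_succ',
        Finset.sum_range_succ', mul_add, Finset.mul_sum, Finset.mul_sum, add_right_comm,
        ← Finset.sum_add_distrib]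
      congr 1
      · refine Finset.sum_congr rfl fun r _ => ?_
        by_cases hr : 2 * r ≤ n
        · rw [if_pos (by omega), if_pos hr]
          -- If `2r = n`, the term of index `r + 1` in the sum of length `n + 1` is padding.
          rcases hr.eq_or_lt with rfl | hr
          · rw [if_neg (by omega), mul_zero, zero_add, Nat.sub_self,
              show 2 * r + 2 - 2 * (r + 1) = 0 by omega]
            exact quadTerm_zero_succ ha0 hq0 h r
          · obtain ⟨s, rfl⟩ : ∃ s, n = s + 1 + 2 * r := ⟨n - 2 * r - 1, by omega⟩
            rw [if_pos (by omega), show s + 1 + 2 * r + 2 - 2 * (r + 1) = s + 1 by omega,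
              show s + 1 + 2 * r + 1 - 2 * (r + 1) = s by omega,
              show s + 1 + 2 * r - 2 * r = s + 1 by omega,
              show s + 1 + 2 * r + 1 = s + 2 * r + 2 by ring]
            exact quadTerm_succ_succ hp ha0 hk0 hq0 hm0 ham h s r
        · rw [if_neg (by omega), if_neg (by omega), if_neg hr, mul_zero, mul_zero, add_zero]
      · simp only [mul_zero, Nat.zero_le, if_true, Nat.sub_zero]
        exact quadTerm_succ_zero hk0 h (n + 1)

end

/-! ### Inversion of the Bailey transform -/

/-- The term with index `s` of the orthogonality relation of length `w + s`. -/
noncomputable def orthTerm (q p a k : ℂ) (w s : ℕ) : ℂ :=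
  modTheta (k * q ^ (2 * s)) p * (ellPoch (a / k) q p w / ellPoch q q p w) *
    (ellPoch a q p (w + 2 * s) / ellPoch (k * q) q p (w + 2 * s)) * (k / a) ^ w *
    (ellPoch (k / a) q p s / ellPoch q q p s * (ellPoch k q p s / ellPoch (a * q) q p s))

/-- The closed form of the partial sums in the orthogonality relation. -/
noncomputable def orthPartial (q p a k : ℂ) (w R : ℕ) : ℂ :=
  -modTheta (k / a) p / (modTheta (q ^ (R + w + 1)) p * modTheta (a * q ^ (R + w + 1)) p) *
    (ellPoch (k * q / a) q p R / ellPoch q q p R) *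
    (ellPoch k q p (R + 1) / ellPoch (a * q) q p R) *
    (ellPoch a q p (2 * R + w + 2) / ellPoch (k * q) q p (2 * R + w + 1)) *
    (ellPoch (a * q / k) q p w / ellPoch q q p w) * (k / a) ^ w

section

variable {q p a k : ℂ}

/-- The addition formula, with a square root of `a` and two reciprocal arguments, in the form needed
to telescope the orthogonality sum. -/
lemma modTheta_orth_identity (hp : ‖p‖ < 1) (ha0 : a ≠ 0) (hk0 : k ≠ 0) (hq0 : q ≠ 0) (R w : ℕ) :
    modTheta (k * q ^ (R + 1)) p * modTheta (k / a * q ^ (R + 1)) p *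
        (modTheta (a * q ^ (2 * R + w + 3)) p * modTheta (q ^ (w + 1)) p) -
      modTheta (k * q ^ (2 * R + 2)) p * modTheta (k / a) p *
        (modTheta (a * q ^ (R + w + 2)) p * modTheta (q ^ (R + w + 2)) p) =
    k / a * (modTheta (k * q ^ (2 * R + w + 3)) p * modTheta (a / k * q ^ (w + 1)) p *
      (modTheta (a * q ^ (R + 1)) p * modTheta (q ^ (R + 1)) p)) := by
  obtain ⟨b, rfl⟩ := exists_sq_eq a
  have hb : b ≠ 0 := by rintro rfl; simp at ha0
  have h1 := modTheta_inv hp (z := b ^ 2 / k * q ^ (w + 1))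
    (mul_ne_zero (div_ne_zero ha0 hk0) (pow_ne_zero _ hq0))
  have h2 := modTheta_inv hp (z := q ^ (R + 1)) (pow_ne_zero _ hq0)
  have h := modTheta_addition_of_eq hp (x := k * q ^ (R + 1) / b) (y := b)
    (u := b * q ^ (R + w + 2)) (v := b * q ^ (R + 1)) (A₁ := k * q ^ (R + 1))
    (A₂ := k / b ^ 2 * q ^ (R + 1)) (A₃ := b ^ 2 * q ^ (2 * R + w + 3)) (A₄ := q ^ (w + 1))
    (B₁ := k * q ^ (2 * R + 2)) (B₂ := k / b ^ 2) (B₃ := b ^ 2 * q ^ (R + w + 2))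
    (B₄ := q ^ (R + w + 2)) (C₁ := k * q ^ (2 * R + w + 3)) (C₂ := (b ^ 2 / k * q ^ (w + 1))⁻¹)
    (C₃ := b ^ 2 * q ^ (R + 1)) (C₄ := (q ^ (R + 1))⁻¹) (c := q ^ (R + w + 2))
    (div_ne_zero (mul_ne_zero hk0 (pow_ne_zero _ hq0)) hb) hb
    (mul_ne_zero hb (pow_ne_zero _ hq0)) (mul_ne_zero hb (pow_ne_zero _ hq0))
    (by field_simp) (by field_simp) (by field_simp; ring) (by field_simp; ring)
    (by field_simp; ring) (by field_simp) (by field_simp) (by field_simp)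
    (by field_simp; ring) (by field_simp; ring) (by field_simp) (by field_simp) (by field_simp)
  rw [h, h1, h2, show q ^ (R + w + 2) = q ^ (w + 1) * q ^ (R + 1) by ring]
  have h3 := pow_ne_zero (w + 1) hq0
  have h4 := pow_ne_zero (R + 1) hq0
  generalize modTheta (b ^ 2 / k * q ^ (w + 1)) p = A
  generalize modTheta (q ^ (R + 1)) p = B
  generalize modTheta (b ^ 2 * q ^ (R + 1)) p = C
  generalize modTheta (k * q ^ (2 * R + w + 3)) p = D
  field_simp

lemma theta_inv_div (hp : ‖p‖ < 1) (ha0 : a ≠ 0) (hk0 : k ≠ 0) :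
    k / a * modTheta (a / k) p = -modTheta (k / a) p := by
  have h := modTheta_inv hp (div_ne_zero hk0 ha0)
  rw [inv_div] at h
  rw [h]
  field_simp

lemma orthPartial_zero (hp : ‖p‖ < 1) (ha0 : a ≠ 0) (hk0 : k ≠ 0)
    (hq : ∀ j : ℕ, modTheta (q * q ^ j) p ≠ 0) (ha : ∀ j : ℕ, modTheta (a * q ^ j) p ≠ 0)
    (hk : ∀ j : ℕ, modTheta (k * q ^ j) p ≠ 0) (w : ℕ) :
    orthPartial q p a k w 0 = orthTerm q p a k (w + 1) 0 := by
  have e1 : ellPoch (a / k) q p (w + 1) = modTheta (a / k) p * ellPoch (a * q / k) q p w :=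
    ellPoch_succ_left (by ring)
  have e2 : ellPoch q q p (w + 1) = ellPoch q q p w * modTheta (q ^ (w + 1)) p :=
    ellPoch_succ_right (by ring)
  have e3 : ellPoch a q p (w + 2) = ellPoch a q p (w + 1) * modTheta (a * q ^ (w + 1)) p :=
    ellPoch_succ_right rfl
  have e4 : ellPoch k q p 1 = modTheta k p := by simp [ellPoch]
  have n1 := ha (w + 1)
  have n2 := modTheta_ne_zero_of_eq hq w (b := q ^ (w + 1)) (by ring)
  have n3 := ellPoch_ne_zero hq w
  have n4 := ellPoch_shift_ne_zero hk 1 (by rw [pow_one]) (w + 1)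
  have hi := theta_inv_div hp ha0 hk0
  simp only [orthPartial, orthTerm, mul_zero, zero_add, add_zero, ellPoch_zero, pow_zero, mul_one,
    div_one]
  rw [e1, e2, e3, e4, pow_succ (k / a), ← hi]
  generalize modTheta (a / k) p = A at *
  generalize ellPoch (a * q / k) q p w = B at *
  generalize k / a = c at *
  generalize modTheta (a * q ^ (w + 1)) p = D at *
  generalize modTheta (q ^ (w + 1)) p = E at *
  generalize ellPoch (k * q) q p (w + 1) = F at *
  field_simp

/-- The rational function identity behind the recursion for `orthPartial`. -/
lemma orth_quotient_identity {X1 X2 X3 X4 Y1 Y2 Y3 Y4 Z1 Z2 Z3 Z4 T c d P1 P2 P3 P4 P5 P6 P7 P8 : ℂ}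
    (key : X1 * X2 * (X3 * X4) - Y1 * Y2 * (Y3 * Y4) = c * (Z1 * Z2 * (Z3 * Z4)))
    (hi : c * T = -Y2) (n1 : Y3 ≠ 0) (n2 : Y4 ≠ 0) (n3 : P8 ≠ 0) (n4 : P2 ≠ 0) (n5 : Z4 ≠ 0)
    (n6 : X4 ≠ 0) (n7 : P4 ≠ 0) (n8 : Z3 ≠ 0) (n9 : P6 ≠ 0) (n10 : Z1 ≠ 0) :
    -Y2 / (Y4 * Y3) * (P1 * X2 / (P2 * Z4)) * (P3 * X1 / (P4 * Z3)) * (P5 * X3 / (P6 * Z1)) *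
        (P7 / P8) * d =
      -Y2 / (Y4 * Y3) * (P1 / P2) * (P3 / P4) * (P5 / P6) * (P7 * Z2 / (P8 * X4)) * (d * c) +
      Y1 * (T * P7 / (P8 * X4)) * (P5 / (P6 * Z1)) * (d * c) *
        (Y2 * P1 / (P2 * Z4) * (P3 / (P4 * Z3))) := by
  have hL : -Y2 / (Y4 * Y3) * (P1 * X2 / (P2 * Z4)) * (P3 * X1 / (P4 * Z3)) *
      (P5 * X3 / (P6 * Z1)) * (P7 / P8) * d =
      -Y2 * P1 * P3 * P5 * P7 * d / (Y4 * Y3 * P2 * Z4 * P4 * Z3 * P6 * Z1 * P8 * X4) *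
        (X1 * X2 * (X3 * X4)) := by
    field_simp
  have h1 : -Y2 / (Y4 * Y3) * (P1 / P2) * (P3 / P4) * (P5 / P6) * (P7 * Z2 / (P8 * X4)) * (d * c) =
      -Y2 * P1 * P3 * P5 * P7 * d / (Y4 * Y3 * P2 * Z4 * P4 * Z3 * P6 * Z1 * P8 * X4) *
        (c * (Z1 * Z2 * (Z3 * Z4))) := by
    field_simp
  have h2 : Y1 * (T * P7 / (P8 * X4)) * (P5 / (P6 * Z1)) * (d * c) *
      (Y2 * P1 / (P2 * Z4) * (P3 / (P4 * Z3))) =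
      -Y2 * P1 * P3 * P5 * P7 * d / (Y4 * Y3 * P2 * Z4 * P4 * Z3 * P6 * Z1 * P8 * X4) *
        (Y1 * -(c * T) * (Y3 * Y4)) := by
    field_simp
  rw [hL, h1, h2, hi, ← key]
  ring

/-- For fixed total length `R + w + 2`, one more summand raises `R` and lowers `w`, so this is the
induction step for the partial sums. -/
lemma orthPartial_succ (hp : ‖p‖ < 1) (ha0 : a ≠ 0) (hk0 : k ≠ 0) (hq0 : q ≠ 0)
    (hq : ∀ j : ℕ, modTheta (q * q ^ j) p ≠ 0) (ha : ∀ j : ℕ, modTheta (a * q ^ j) p ≠ 0)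
    (hk : ∀ j : ℕ, modTheta (k * q ^ j) p ≠ 0) (w R : ℕ) :
    orthPartial q p a k w (R + 1) =
      orthPartial q p a k (w + 1) R + orthTerm q p a k (w + 1) (R + 1) := by
  have key := modTheta_orth_identity hp ha0 hk0 hq0 R w
  have hi := theta_inv_div hp ha0 hk0
  have e1 : ellPoch (k * q / a) q p (R + 1) = ellPoch (k * q / a) q p R *
    modTheta (k / a * q ^ (R + 1)) p := ellPoch_succ_right (by ring)
  have e2 : ellPoch (k / a) q p (R + 1) = modTheta (k / a) p * ellPoch (k * q / a) q p R :=
    ellPoch_succ_left (by ring)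
  have e3 : ellPoch q q p (R + 1) = ellPoch q q p R * modTheta (q ^ (R + 1)) p :=
    ellPoch_succ_right (by ring)
  have e4 : ellPoch k q p (R + 2) = ellPoch k q p (R + 1) * modTheta (k * q ^ (R + 1)) p :=
    ellPoch_succ_right rfl
  have e5 : ellPoch (a * q) q p (R + 1) = ellPoch (a * q) q p R * modTheta (a * q ^ (R + 1)) p :=
    ellPoch_succ_right (by ring)
  have e6 : ellPoch a q p (2 * R + w + 4) = ellPoch a q p (2 * R + w + 3) *
    modTheta (a * q ^ (2 * R + w + 3)) p := ellPoch_succ_right rfl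
  have e7 : ellPoch (k * q) q p (2 * R + w + 3) = ellPoch (k * q) q p (2 * R + w + 2) *
    modTheta (k * q ^ (2 * R + w + 3)) p := ellPoch_succ_right (by ring)
  have e8 : ellPoch (a * q / k) q p (w + 1) = ellPoch (a * q / k) q p w *
    modTheta (a / k * q ^ (w + 1)) p := ellPoch_succ_right (by ring)
  have e9 : ellPoch (a / k) q p (w + 1) = modTheta (a / k) p * ellPoch (a * q / k) q p w :=
    ellPoch_succ_left (by ring)
  have e10 : ellPoch q q p (w + 1) = ellPoch q q p w * modTheta (q ^ (w + 1)) p :=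
    ellPoch_succ_right (by ring)
  have n1 := ha (R + w + 2)
  have n2 := modTheta_ne_zero_of_eq hq (R + w + 1) (b := q ^ (R + w + 2)) (by ring)
  have n3 := ellPoch_ne_zero hq w
  have n4 := ellPoch_ne_zero hq R
  have n5 := modTheta_ne_zero_of_eq hq R (b := q ^ (R + 1)) (by ring)
  have n6 := modTheta_ne_zero_of_eq hq w (b := q ^ (w + 1)) (by ring)
  have n7 := ellPoch_shift_ne_zero ha 1 (by rw [pow_one]) R
  have n8 := ha (R + 1)
  have n9 := ellPoch_shift_ne_zero hk 1 (by rw [pow_one]) (2 * R + w + 2)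
  have n10 := hk (2 * R + w + 3)
  simp only [orthPartial, orthTerm]
  rw [show R + 1 + w + 1 = R + w + 2 by ring, show R + (w + 1) + 1 = R + w + 2 by ring,
    show 2 * (R + 1) + w + 2 = 2 * R + w + 4 by ring,
    show 2 * (R + 1) + w + 1 = 2 * R + w + 3 by ring,
    show 2 * R + (w + 1) + 2 = 2 * R + w + 3 by ring,
    show 2 * R + (w + 1) + 1 = 2 * R + w + 2 by ring,
    show w + 1 + 2 * (R + 1) = 2 * R + w + 3 by ring, show 2 * (R + 1) = 2 * R + 2 by ring,
    show R + 1 + 1 = R + 2 by ring, e1, e2, e3, e4, e5, e6, e7, e8, e9, e10, pow_succ (k / a) w]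
  exact orth_quotient_identity key hi n1 n2 n3 n4 n5 n6 n7 n8 n9 n10

/-- At `w = 0` only one summand is missing, and it is the negative of the partial sum. -/
lemma orthPartial_add_orthTerm (hq : ∀ j : ℕ, modTheta (q * q ^ j) p ≠ 0)
    (ha : ∀ j : ℕ, modTheta (a * q ^ j) p ≠ 0)
    (hk : ∀ j : ℕ, modTheta (k * q ^ j) p ≠ 0) (n : ℕ) :
    orthPartial q p a k 0 n + orthTerm q p a k 0 (n + 1) = 0 := by
  have e2 : ellPoch (k / a) q p (n + 1) = modTheta (k / a) p * ellPoch (k * q / a) q p n :=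
    ellPoch_succ_left (by ring)
  have e3 : ellPoch q q p (n + 1) = ellPoch q q p n * modTheta (q ^ (n + 1)) p :=
    ellPoch_succ_right (by ring)
  have e5 : ellPoch (a * q) q p (n + 1) = ellPoch (a * q) q p n * modTheta (a * q ^ (n + 1)) p :=
    ellPoch_succ_right (by ring)
  have e7 : ellPoch (k * q) q p (2 * n + 2) = ellPoch (k * q) q p (2 * n + 1) *
    modTheta (k * q ^ (2 * n + 2)) p := ellPoch_succ_right (by ring)
  have n1 := ha (n + 1)
  have n2 := modTheta_ne_zero_of_eq hq n (b := q ^ (n + 1)) (by ring)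
  have n4 := ellPoch_ne_zero hq n
  have n7 := ellPoch_shift_ne_zero ha 1 (by rw [pow_one]) n
  have n9 := ellPoch_shift_ne_zero hk 1 (by rw [pow_one]) (2 * n + 1)
  have n10 := hk (2 * n + 2)
  simp only [orthPartial, orthTerm, add_zero, zero_add, ellPoch_zero, pow_zero, mul_one, div_one]
  rw [show 2 * (n + 1) = 2 * n + 2 by ring, e2, e3, e5, e7]
  generalize modTheta (k / a) p = A at *
  generalize ellPoch (k * q / a) q p n = B at *
  field_simp
  ring

lemma sum_orthTerm_partial (hp : ‖p‖ < 1) (ha0 : a ≠ 0) (hk0 : k ≠ 0) (hq0 : q ≠ 0)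
    (hq : ∀ j : ℕ, modTheta (q * q ^ j) p ≠ 0) (ha : ∀ j : ℕ, modTheta (a * q ^ j) p ≠ 0)
    (hk : ∀ j : ℕ, modTheta (k * q ^ j) p ≠ 0) (R : ℕ) : ∀ w : ℕ,
    ∑ s ∈ Finset.range (R + 1), orthTerm q p a k (R + w + 1 - s) s = orthPartial q p a k w R := by
  induction R with
  | zero =>
    intro w
    rw [orthPartial_zero hp ha0 hk0 hq ha hk]
    simp
  | succ R ih =>
    intro w
    rw [Finset.sum_range_succ, orthPartial_succ hp ha0 hk0 hq0 hq ha hk, ← ih (w + 1),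
      show R + 1 + w + 1 = R + (w + 1) + 1 by ring,
      show R + (w + 1) + 1 - (R + 1) = w + 1 by omega]

/-- The orthogonality relation for the kernels of the Bailey transform. -/
lemma sum_orthTerm_eq_zero (hp : ‖p‖ < 1) (ha0 : a ≠ 0) (hk0 : k ≠ 0) (hq0 : q ≠ 0)
    (hq : ∀ j : ℕ, modTheta (q * q ^ j) p ≠ 0) (ha : ∀ j : ℕ, modTheta (a * q ^ j) p ≠ 0)
    (hk : ∀ j : ℕ, modTheta (k * q ^ j) p ≠ 0) {N : ℕ} (hN : N ≠ 0) :
    ∑ s ∈ Finset.range (N + 1), orthTerm q p a k (N - s) s = 0 := by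
  obtain ⟨n, rfl⟩ := Nat.exists_eq_succ_of_ne_zero hN
  have h := sum_orthTerm_partial hp ha0 hk0 hq0 hq ha hk n 0
  rw [Nat.succ_eq_add_one, Finset.sum_range_succ, Nat.sub_self]
  rw [add_zero] at h
  rw [h, orthPartial_add_orthTerm hq ha hk]

/-- The coefficients of `α` in the first Bailey transform equation. -/
noncomputable def baileyKernel (q p a k : ℂ) (n r : ℕ) : ℂ :=
  ellPoch (k / a) q p (n - r) / ellPoch q q p (n - r) *
    (ellPoch k q p (n + r) / ellPoch (a * q) q p (n + r))

/-- The summand of the inverse Bailey transform. -/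
noncomputable def baileyInvKernel (q p a k : ℂ) (n r : ℕ) : ℂ :=
  modTheta (k * q ^ (2 * r)) p / modTheta k p *
    (ellPoch (a / k) q p (n - r) / ellPoch q q p (n - r)) *
    (ellPoch a q p (n + r) / ellPoch (k * q) q p (n + r)) * (k / a) ^ (n - r)

/-- Splitting off the factorials of length `2j` leaves the ratio `k/a` unchanged, so the product of
the two kernels is an orthogonality summand at `(aq^(2j), kq^(2j))`, up to a factor independent of
`s`. -/
lemma baileyInvKernel_mul_baileyKernel (hq0 : q ≠ 0) (j N s : ℕ) (hs : s ≤ N) :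
    baileyInvKernel q p a k (j + N) (j + s) * baileyKernel q p a k (j + s) j =
      ellPoch a q p (2 * j) / (modTheta k p * ellPoch (k * q) q p (2 * j)) *
        (ellPoch k q p (2 * j) / ellPoch (a * q) q p (2 * j)) *
        orthTerm q p (a * q ^ (2 * j)) (k * q ^ (2 * j)) (N - s) s := by
  have hqj := pow_ne_zero (2 * j) hq0
  rw [baileyInvKernel, baileyKernel, orthTerm, Nat.add_sub_add_left, Nat.add_sub_cancel_left,
    mul_div_mul_right _ _ hqj, mul_div_mul_right _ _ hqj,
    show j + N + (j + s) = 2 * j + (N - s + 2 * s) by omega, show j + s + j = 2 * j + s by omega,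
    ellPoch_add (m := 2 * j) (b := a * q ^ (2 * j)) rfl,
    ellPoch_add (a := k * q) (m := 2 * j) (b := k * q ^ (2 * j) * q) (by ring),
    ellPoch_add (a := k) (m := 2 * j) rfl,
    ellPoch_add (a := a * q) (m := 2 * j) (b := a * q ^ (2 * j) * q) (by ring),
    show k * q ^ (2 * (j + s)) = k * q ^ (2 * j) * q ^ (2 * s) by ring]
  ring

lemma sum_range_triangle (n : ℕ) (f : ℕ → ℕ → ℂ) :
    ∑ r ∈ Finset.range (n + 1), ∑ j ∈ Finset.range (r + 1), f r j =
      ∑ j ∈ Finset.range (n + 1), ∑ s ∈ Finset.range (n + 1 - j), f (j + s) j := by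
  rw [Finset.sum_comm' (t' := Finset.range (n + 1)) (s' := fun j => Finset.Ico j (n + 1))]
  · exact Finset.sum_congr rfl fun j _ => Finset.sum_Ico_eq_sum_range _ _ _
  · intro r j
    simp only [Finset.mem_range, Finset.mem_Ico]
    omega

/-- The first equation of a Bailey pair implies the second. -/
lemma bailey_inversion (hp : ‖p‖ < 1) (ha0 : a ≠ 0) (hk0 : k ≠ 0) (hq0 : q ≠ 0)
    (hq : ∀ j : ℕ, modTheta (q * q ^ j) p ≠ 0) (ha : ∀ j : ℕ, modTheta (a * q ^ j) p ≠ 0)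
    (hk : ∀ j : ℕ, modTheta (k * q ^ j) p ≠ 0) {A B : ℕ → ℂ}
    (hB : ∀ n, B n = ∑ r ∈ Finset.range (n + 1), baileyKernel q p a k n r * A r) (n : ℕ) :
    A n = modTheta (a * q ^ (2 * n)) p / modTheta a p *
      ∑ r ∈ Finset.range (n + 1), baileyInvKernel q p a k n r * B r := by
  simp only [hB, Finset.mul_sum]
  rw [sum_range_triangle n fun r j => modTheta (a * q ^ (2 * n)) p / modTheta a p *
    (baileyInvKernel q p a k n r * (baileyKernel q p a k r j * A j)), Finset.sum_range_succ,
    Finset.sum_eq_zero fun j hj => ?_]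
  -- The diagonal coefficient is `1`: both `(a;q,p)_(2n+1)` and `(k;q,p)_(2n+1)` are factored from
  -- either end.
  · have n1 := modTheta_ne_zero_of_eq ha 0 (b := a) (by ring)
    have n2 := modTheta_ne_zero_of_eq hk 0 (b := k) (by ring)
    have n3 := ellPoch_shift_ne_zero ha 1 (by rw [pow_one]) (2 * n)
    have n4 := ellPoch_shift_ne_zero hk 1 (by rw [pow_one]) (2 * n)
    have e1 : modTheta a p * ellPoch (a * q) q p (2 * n) = ellPoch a q p (2 * n) *
        modTheta (a * q ^ (2 * n)) p := by
      rw [← ellPoch_succ_left rfl, ellPoch_succ_right rfl]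
    have e2 : modTheta k p * ellPoch (k * q) q p (2 * n) = ellPoch k q p (2 * n) *
        modTheta (k * q ^ (2 * n)) p := by
      rw [← ellPoch_succ_left rfl, ellPoch_succ_right rfl]
    rw [Nat.add_sub_cancel_left, Finset.sum_range_one, zero_add, add_zero, baileyInvKernel,
      baileyKernel, Nat.sub_self, ← two_mul]
    simp only [ellPoch_zero, pow_zero, div_one, mul_one]
    rw [show modTheta (a * q ^ (2 * n)) p / modTheta a p * (modTheta (k * q ^ (2 * n)) p /
      modTheta k p * (ellPoch a q p (2 * n) / ellPoch (k * q) q p (2 * n)) *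
      (1 * (ellPoch k q p (2 * n) / ellPoch (a * q) q p (2 * n)) * A n)) =
      (ellPoch a q p (2 * n) * modTheta (a * q ^ (2 * n)) p) /
        (modTheta a p * ellPoch (a * q) q p (2 * n)) * ((ellPoch k q p (2 * n) *
        modTheta (k * q ^ (2 * n)) p) / (modTheta k p * ellPoch (k * q) q p (2 * n))) * A n by ring,
      ← e1, ← e2, div_self (mul_ne_zero n1 n3), div_self (mul_ne_zero n2 n4), one_mul, one_mul]
  -- The coefficients with `j < n` vanish by orthogonality of length `N = n - j > 0`.
  · obtain ⟨N, rfl⟩ : ∃ N, n = j + N := ⟨n - j, by have := Finset.mem_range.1 hj; omega⟩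
    have hN : N ≠ 0 := by have := Finset.mem_range.1 hj; omega
    have h0 := sum_orthTerm_eq_zero hp (mul_ne_zero ha0 (pow_ne_zero (2 * j) hq0))
      (mul_ne_zero hk0 (pow_ne_zero (2 * j) hq0)) hq0 hq (modTheta_shift_ne_zero ha (2 * j) rfl)
      (modTheta_shift_ne_zero hk (2 * j) rfl) hN
    rw [show j + N + 1 - j = N + 1 by omega]
    refine Eq.trans (Finset.sum_congr rfl fun s hs => ?_) ((Finset.mul_sum _ _ _).symm.trans
      ((congrArg (modTheta (a * q ^ (2 * (j + N))) p / modTheta a p *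
        (ellPoch a q p (2 * j) / (modTheta k p * ellPoch (k * q) q p (2 * j)) *
        (ellPoch k q p (2 * j) / ellPoch (a * q) q p (2 * j))) * A j * ·) h0).trans (mul_zero _)))
    have h1 := baileyInvKernel_mul_baileyKernel (p := p) (a := a) (k := k) hq0 j N s
      (Nat.lt_succ_iff.1 (Finset.mem_range.1 hs))
    linear_combination modTheta (a * q ^ (2 * (j + N))) p / modTheta a p * A j * h1

end

/-! ### The quadratic transformation of Bailey pairs -/

section

variable {q p a k m : ℂ}

/-- The summand of the new `β` sequence, without the factor `β_r`. -/
noncomputable def quadKernel (q p a k m : ℂ) (n r : ℕ) : ℂ :=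
  modTheta (m * q ^ (4 * r)) p / modTheta m p *
    (ellPoch (k / m) q p (n - 2 * r) / ellPoch q q p (n - 2 * r)) *
    (ellPoch k q p (n + 2 * r) / ellPoch (m * q) q p (n + 2 * r)) * (-(k / a)) ^ (n - 2 * r)

/-- Base `q` meets base `q²` here: by `ellPoch_two_mul` a base `q` factorial of length `4j` splits
into two base `q²` factorials of length `2j`, which cancel those from the other kernel. The relation
`k/m = a/k` gives the form used in `quadTerm`. -/
lemma quadKernel_mul_baileyKernel (hk0 : k ≠ 0) (hm0 : m ≠ 0) (hq0 : q ≠ 0)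
    (ham : a * m = k ^ 2) (h : QuadRegular q p a k m) (j N i : ℕ) (hi : 2 * i ≤ N) :
    ellPoch (m * q) (q ^ 2) p (2 * j + N) / ellPoch (a * q) (q ^ 2) p (2 * j + N) *
        (quadKernel q p a k m (2 * j + N) (j + i) * baileyKernel (q ^ 2) p a m (j + i) j) =
      ellPoch k q p (4 * j) / ellPoch (a * q) q p (4 * j) *
        quadTerm q p (a * q ^ (4 * j)) (k * q ^ (4 * j)) (m * q ^ (4 * j)) (N - 2 * i) i := by
  obtain ⟨s, rfl⟩ : ∃ s, N = s + 2 * i := ⟨N - 2 * i, by omega⟩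
  have hqj := pow_ne_zero (4 * j) hq0
  have hkm : k / m = a / k := by
    rw [div_eq_div_iff hm0 hk0]; linear_combination -ham
  have e1 : ellPoch (m * q) (q ^ 2) p (2 * j + (s + 2 * i)) = ellPoch (m * q) (q ^ 2) p (2 * j) *
      ellPoch (m * q ^ (4 * j) * q) (q ^ 2) p (s + 2 * i) := ellPoch_add (by ring)
  have e2 : ellPoch (a * q) (q ^ 2) p (2 * j + (s + 2 * i)) = ellPoch (a * q) (q ^ 2) p (2 * j) *
      ellPoch (a * q ^ (4 * j) * q) (q ^ 2) p (s + 2 * i) := ellPoch_add (by ring)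
  have e3 : ellPoch k q p (4 * j + (s + 4 * i)) = ellPoch k q p (4 * j) *
      ellPoch (k * q ^ (4 * j)) q p (s + 4 * i) := ellPoch_add rfl
  have e4 : ellPoch (m * q) q p (4 * j + (s + 4 * i)) = ellPoch (m * q) q p (4 * j) *
      ellPoch (m * q ^ (4 * j) * q) q p (s + 4 * i) := ellPoch_add (by ring)
  have e5 : ellPoch m (q ^ 2) p (2 * j + i) = ellPoch m (q ^ 2) p (2 * j) *
      ellPoch (m * q ^ (4 * j)) (q ^ 2) p i := ellPoch_add (by ring)
  have e6 : ellPoch (a * q ^ 2) (q ^ 2) p (2 * j + i) = ellPoch (a * q ^ 2) (q ^ 2) p (2 * j) *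
      ellPoch (a * q ^ (4 * j) * q ^ 2) (q ^ 2) p i := ellPoch_add (by ring)
  have e7 : ellPoch (m * q) q p (4 * j) = ellPoch (m * q) (q ^ 2) p (2 * j) *
      ellPoch (m * q ^ 2) (q ^ 2) p (2 * j) := by
    rw [show 4 * j = 2 * (2 * j) by ring, ellPoch_two_mul, show m * q * q = m * q ^ 2 by ring]
  have e8 : ellPoch (a * q) q p (4 * j) = ellPoch (a * q) (q ^ 2) p (2 * j) *
      ellPoch (a * q ^ 2) (q ^ 2) p (2 * j) := by
    rw [show 4 * j = 2 * (2 * j) by ring, ellPoch_two_mul, show a * q * q = a * q ^ 2 by ring]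
  have e9 : modTheta m p * ellPoch (m * q ^ 2) (q ^ 2) p (2 * j) = ellPoch m (q ^ 2) p (2 * j) *
      modTheta (m * q ^ (4 * j)) p := by
    rw [← ellPoch_succ_left rfl, ellPoch_succ_right (b := m * q ^ (4 * j)) (by ring)]
  have n1 := modTheta_ne_zero_of_eq h.hm 0 (b := m) (by ring)
  have n2 := h.hm (4 * j)
  have n3 := ellPoch_sq_shift_ne_zero h.hm 1 (b := m * q) (by ring) (2 * j)
  have n4 := ellPoch_sq_shift_ne_zero h.hm 2 rfl (2 * j)
  have f9 := eq_div_of_mul_eq n2 e9.symm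
  rw [quadKernel, baileyKernel, quadTerm, hkm, mul_div_mul_right _ _ hqj,
    mul_div_mul_right _ _ hqj, mul_div_mul_right _ _ hqj, Nat.add_sub_cancel_left,
    show 2 * j + (s + 2 * i) - 2 * (j + i) = s by omega, show s + 2 * i - 2 * i = s by omega,
    show 2 * j + (s + 2 * i) + 2 * (j + i) = 4 * j + (s + 4 * i) by ring,
    show j + i + j = 2 * j + i by ring, e1, e2, e3, e4, e5, e6, e7, e8, f9,
    show m * q ^ (4 * (j + i)) = m * q ^ (4 * j) * q ^ (4 * i) by ring]
  generalize modTheta m p = t1 at *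
  generalize modTheta (m * q ^ (4 * j)) p = t2 at *
  generalize ellPoch (m * q) (q ^ 2) p (2 * j) = t3 at *
  generalize ellPoch (m * q ^ 2) (q ^ 2) p (2 * j) = t4 at *
  have c1 : t1 * t1⁻¹ = 1 := mul_inv_cancel₀ n1
  have c3 : t3 * t3⁻¹ = 1 := mul_inv_cancel₀ n3
  have c4 : t4 * t4⁻¹ = 1 := mul_inv_cancel₀ n4
  calc _ = (t1 * t1⁻¹) * (t3 * t3⁻¹) * (t4 * t4⁻¹) * (ellPoch k q p (4 * j) /
        (ellPoch (a * q) (q ^ 2) p (2 * j) * ellPoch (a * q ^ 2) (q ^ 2) p (2 * j)) *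
        (ellPoch (m * q ^ (4 * j) * q) (q ^ 2) p (s + 2 * i) /
          ellPoch (a * q ^ (4 * j) * q) (q ^ 2) p (s + 2 * i) *
        (modTheta (m * q ^ (4 * j) * q ^ (4 * i)) p / t2 *
        (ellPoch (a / k) q p s / ellPoch q q p s) *
        (ellPoch (k * q ^ (4 * j)) q p (s + 4 * i) /
          ellPoch (m * q ^ (4 * j) * q) q p (s + 4 * i)) *
        (-(k / a)) ^ s * (ellPoch (m / a) (q ^ 2) p i / ellPoch (q ^ 2) (q ^ 2) p i *
        (ellPoch (m * q ^ (4 * j)) (q ^ 2) p i /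
          ellPoch (a * q ^ (4 * j) * q ^ 2) (q ^ 2) p i))))) := by ring
    _ = _ := by rw [c1, c3, c4, one_mul, one_mul, one_mul]

lemma baileyKernel_two_mul (hq0 : q ≠ 0) (j N : ℕ) :
    baileyKernel q p a k (2 * j + N) (2 * j) = ellPoch k q p (4 * j) / ellPoch (a * q) q p (4 * j) *
      quadValue q p (a * q ^ (4 * j)) (k * q ^ (4 * j)) N := by
  rw [baileyKernel, quadValue, Nat.add_sub_cancel_left, mul_div_mul_right _ _ (pow_ne_zero _ hq0),
    show 2 * j + N + 2 * j = 4 * j + N by ring, ellPoch_add (b := k * q ^ (4 * j)) rfl,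
    ellPoch_add (a := a * q) (b := a * q ^ (4 * j) * q) (by ring)]
  ring

/-- The quadratic summation of length `n - 2j` at the parameters multiplied by `q^(4j)`. -/
lemma sum_quadKernel_mul_baileyKernel (hp : ‖p‖ < 1) (hk0 : k ≠ 0) (hm0 : m ≠ 0) (ha0 : a ≠ 0)
    (hq0 : q ≠ 0) (ham : a * m = k ^ 2) (h : QuadRegular q p a k m) {n j : ℕ} (hj : 2 * j ≤ n) :
    ∑ i ∈ Finset.range (n / 2 + 1 - j),
      ellPoch (m * q) (q ^ 2) p n / ellPoch (a * q) (q ^ 2) p n *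
        (quadKernel q p a k m n (j + i) * baileyKernel (q ^ 2) p a m (j + i) j) =
      baileyKernel q p a k n (2 * j) := by
  obtain ⟨N, rfl⟩ : ∃ N, n = 2 * j + N := ⟨n - 2 * j, by omega⟩
  have hqj := pow_ne_zero (4 * j) hq0
  rw [baileyKernel_two_mul hq0, ← sum_quadTerm_eq hp hq0 N (mul_ne_zero ha0 hqj)
    (mul_ne_zero hk0 hqj) (mul_ne_zero hm0 hqj) (by linear_combination (q ^ (4 * j)) ^ 2 * ham)
    ⟨h.hq, modTheta_shift_ne_zero h.ha (4 * j) rfl, modTheta_shift_ne_zero h.hk (4 * j) rfl,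
      modTheta_shift_ne_zero h.hm (4 * j) rfl⟩ ((2 * j + N) / 2 + 1 - j) (by omega),
    Finset.mul_sum]
  refine Finset.sum_congr rfl fun i hi => ?_
  have hi' : 2 * i ≤ N := by have := Finset.mem_range.1 hi; omega
  rw [if_pos hi', quadKernel_mul_baileyKernel hk0 hm0 hq0 ham h j N i hi']

lemma sum_range_even (n : ℕ) (f g : ℕ → ℂ) :
    ∑ r ∈ Finset.range (n + 1), f r * (if Even r then g (r / 2) else 0) =
      ∑ j ∈ Finset.range (n / 2 + 1), f (2 * j) * g j := by
  simp only [mul_ite, mul_zero]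
  rw [← Finset.sum_filter]
  refine Finset.sum_nbij' (fun r => r / 2) (fun j => 2 * j) ?_ ?_ ?_ ?_ ?_
  · intro r hr
    simp only [Finset.mem_filter, Finset.mem_range] at hr ⊢
    omega
  · intro j hj
    simp only [Finset.mem_filter, Finset.mem_range] at hj ⊢
    exact ⟨by omega, even_two_mul j⟩
  · intro r hr
    exact Nat.two_mul_div_two_of_even (Finset.mem_filter.1 hr).2
  · intro j _
    exact Nat.mul_div_cancel_left j two_pos
  · intro r hr
    rw [Nat.two_mul_div_two_of_even (Finset.mem_filter.1 hr).2]

/-- The quadratic transformation of elliptic WP Bailey pairs. -/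
theorem IsEllipticWPBaileyPair.quadratic {α β : ℕ → ℂ → ℂ → ℂ → ℂ → ℂ} (hp : ‖p‖ < 1)
    (ha0 : a ≠ 0) (hk0 : k ≠ 0) (hq0 : q ≠ 0) (h : QuadRegular q p a k (k ^ 2 / a))
    (hpair : IsEllipticWPBaileyPair α β a (k ^ 2 / a) (q ^ 2) p) :
    IsEllipticWPBaileyPair (ellAlphaNew α) (ellBetaNew β) a k q p := by
  have hm0 : k ^ 2 / a ≠ 0 := div_ne_zero (pow_ne_zero 2 hk0) ha0
  have ham : a * (k ^ 2 / a) = k ^ 2 := mul_div_cancel₀ _ ha0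
  have hB : ∀ n, ellBetaNew β n a k q p =
      ∑ r ∈ Finset.range (n + 1), baileyKernel q p a k n r * ellAlphaNew α r a k q p := by
    intro n
    have h1 : ellBetaNew β n a k q p = ∑ r ∈ Finset.range (n / 2 + 1),
        ∑ j ∈ Finset.range (r + 1), ellPoch (k ^ 2 / a * q) (q ^ 2) p n /
          ellPoch (a * q) (q ^ 2) p n * (quadKernel q p a k (k ^ 2 / a) n r *
          baileyKernel (q ^ 2) p a (k ^ 2 / a) r j) * α j a (k ^ 2 / a) (q ^ 2) p := by
      rw [ellBetaNew, Finset.mul_sum]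
      refine Finset.sum_congr rfl fun r _ => ?_
      rw [hpair.1 r, Finset.mul_sum, Finset.mul_sum]
      refine Finset.sum_congr rfl fun j _ => ?_
      rw [quadKernel, baileyKernel]
      ring
    -- After the exchange, the inner sum is the coefficient of `α_j`; on the other side only even
    -- indices contribute.
    rw [h1, sum_range_triangle (n / 2) fun r j => ellPoch (k ^ 2 / a * q) (q ^ 2) p n /
      ellPoch (a * q) (q ^ 2) p n * (quadKernel q p a k (k ^ 2 / a) n r *
      baileyKernel (q ^ 2) p a (k ^ 2 / a) r j) * α j a (k ^ 2 / a) (q ^ 2) p]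
    simp only [ellAlphaNew]
    rw [sum_range_even n (baileyKernel q p a k n) fun j => α j a (k ^ 2 / a) (q ^ 2) p]
    refine Finset.sum_congr rfl fun j hj => ?_
    rw [← Finset.sum_mul, sum_quadKernel_mul_baileyKernel hp hk0 hm0 ha0 hq0 ham h
      (by have := Finset.mem_range.1 hj; omega)]
  exact ⟨hB, bailey_inversion hp ha0 hk0 hq0 h.hq h.ha h.hk hB⟩

/-! ### Specialization to `p = 0` and the limit `p → 0`. -/

lemma ellPoch_base_zero (a q : ℂ) (n : ℕ) : ellPoch a q 0 n = basicPoch a q n := by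
  simp [ellPoch, basicPoch, modTheta_base_zero]

/-- Families constant in `p` turn the basic statement into the elliptic one at `p = 0`, so the basic
transformation needs no limiting argument. -/
lemma isEllipticWPBaileyPair_base_zero (α β : ℕ → ℂ → ℂ → ℂ → ℂ) (a k q : ℂ) :
    IsEllipticWPBaileyPair (fun n a k q _ => α n a k q) (fun n a k q _ => β n a k q) a k q 0 ↔
      IsBasicWPBaileyPair α β a k q := by
  simp only [IsEllipticWPBaileyPair, IsBasicWPBaileyPair, ellPoch_base_zero, modTheta_base_zero]

lemma tendsto_modTheta_basic (z : ℂ) : Tendsto (modTheta z) (𝓝[≠] 0) (𝓝 (1 - z)) := by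
  have h := tendsto_modTheta_zero z
  rw [modTheta_base_zero] at h
  exact h.mono_left nhdsWithin_le_nhds

lemma tendsto_ellPoch_basic (a q : ℂ) (n : ℕ) :
    Tendsto (fun p => ellPoch a q p n) (𝓝[≠] 0) (𝓝 (basicPoch a q n)) :=
  tendsto_finsetProd _ fun _ _ => tendsto_modTheta_basic _

lemma basicPoch_ne_zero {a q : ℂ} (h : ∀ j : ℕ, a * q ^ j ≠ 1) (n : ℕ) : basicPoch a q n ≠ 0 :=
  Finset.prod_ne_zero_iff.2 fun j _ => sub_ne_zero.2 (h j).symm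

/-- The sum is finite, so it suffices that the limits of all denominators, namely `1 - m`, `(q;q)`,
`(mq;q)` and `(aq;q²)`, are nonzero. -/
lemma tendsto_ellBetaNew {β : ℕ → ℂ → ℂ → ℂ → ℂ → ℂ} {β₀ : ℕ → ℂ → ℂ → ℂ → ℂ}
    (hq : ∀ j : ℕ, q ^ (j + 1) ≠ 1) (ha : ∀ j : ℕ, a * q ^ j ≠ 1)
    (hm : ∀ j : ℕ, k ^ 2 / a * q ^ j ≠ 1)
    (hβ : ∀ n : ℕ, Tendsto (fun p : ℂ => β n a (k ^ 2 / a) (q ^ 2) p) (𝓝[≠] 0)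
      (𝓝 (β₀ n a (k ^ 2 / a) (q ^ 2)))) (n : ℕ) :
    Tendsto (fun p : ℂ => ellBetaNew β n a k q p) (𝓝[≠] 0) (𝓝 (basicBetaNew β₀ n a k q)) := by
  unfold ellBetaNew basicBetaNew
  have n1 : ∀ n, basicPoch q q n ≠ 0 := basicPoch_ne_zero fun j => by
    rw [← pow_succ']; exact hq j
  have n2 : ∀ n, basicPoch (k ^ 2 / a * q) q n ≠ 0 := basicPoch_ne_zero fun j => by
    rw [mul_assoc, ← pow_succ']; exact hm _
  have n3 : ∀ n, basicPoch (a * q) (q ^ 2) n ≠ 0 := basicPoch_ne_zero fun j => by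
    rw [mul_assoc, ← pow_mul, ← pow_succ']; exact ha _
  have n4 : 1 - k ^ 2 / a ≠ 0 := sub_ne_zero.2 (by simpa using (hm 0).symm)
  refine Tendsto.mul ((tendsto_ellPoch_basic _ _ _).div (tendsto_ellPoch_basic _ _ _) (n3 n))
    (tendsto_finsetSum _ fun r _ => ?_)
  exact (((((tendsto_modTheta_basic _).div (tendsto_modTheta_basic _) n4).mul
    ((tendsto_ellPoch_basic _ _ _).div (tendsto_ellPoch_basic _ _ _) (n1 _))).mul
    ((tendsto_ellPoch_basic _ _ _).div (tendsto_ellPoch_basic _ _ _) (n2 _))).mul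
    tendsto_const_nhds).mul (hβ r)

end

theorem theorem3p4 :
    -- the elliptic transformation
    (∀ (α β : ℕ → ℂ → ℂ → ℂ → ℂ → ℂ) (a k q p : ℂ),
      ‖p‖ < 1 → a ≠ 0 → k ≠ 0 → q ≠ 0 →
      (∀ j : ℕ, modTheta (q ^ (j + 1)) p ≠ 0) →
      (∀ j : ℕ, modTheta (a * q ^ j) p ≠ 0) →
      (∀ j : ℕ, modTheta (k * q ^ j) p ≠ 0) →
      (∀ j : ℕ, modTheta (k ^ 2 / a * q ^ j) p ≠ 0) →
      IsEllipticWPBaileyPair α β a (k ^ 2 / a) (q ^ 2) p →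
      IsEllipticWPBaileyPair (ellAlphaNew α) (ellBetaNew β) a k q p) ∧
    -- the limit `p → 0`
    (∀ (α₀ β₀ : ℕ → ℂ → ℂ → ℂ → ℂ) (a k q : ℂ),
      a ≠ 0 → k ≠ 0 → q ≠ 0 →
      (∀ j : ℕ, q ^ (j + 1) ≠ 1) →
      (∀ j : ℕ, a * q ^ j ≠ 1) →
      (∀ j : ℕ, k * q ^ j ≠ 1) →
      (∀ j : ℕ, k ^ 2 / a * q ^ j ≠ 1) →
      -- the transformation of basic WP Bailey pairs
      (IsBasicWPBaileyPair α₀ β₀ a (k ^ 2 / a) (q ^ 2) →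
        IsBasicWPBaileyPair (basicAlphaNew α₀) (basicBetaNew β₀) a k q) ∧
      -- the elliptic transformation tends to the basic one
      (∀ α β : ℕ → ℂ → ℂ → ℂ → ℂ → ℂ,
        (∀ n : ℕ, Tendsto (fun p : ℂ => α n a (k ^ 2 / a) (q ^ 2) p) (𝓝[≠] 0)
          (𝓝 (α₀ n a (k ^ 2 / a) (q ^ 2)))) →
        (∀ n : ℕ, Tendsto (fun p : ℂ => β n a (k ^ 2 / a) (q ^ 2) p) (𝓝[≠] 0)
          (𝓝 (β₀ n a (k ^ 2 / a) (q ^ 2)))) →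
        ∀ n : ℕ,
          Tendsto (fun p : ℂ => ellAlphaNew α n a k q p) (𝓝[≠] 0)
            (𝓝 (basicAlphaNew α₀ n a k q)) ∧
          Tendsto (fun p : ℂ => ellBetaNew β n a k q p) (𝓝[≠] 0)
            (𝓝 (basicBetaNew β₀ n a k q)))) := by
  constructor
  · intro α β a k q p hp ha0 hk0 hq0 hq ha hk hm hpair
    exact hpair.quadratic hp ha0 hk0 hq0 ⟨fun j => by rw [← pow_succ']; exact hq j, ha, hk, hm⟩
  · intro α₀ β₀ a k q ha0 hk0 hq0 hq ha hk hm
    refine ⟨fun hpair => ?_, fun α β hα hβ n => ⟨?_, tendsto_ellBetaNew hq ha hm hβ n⟩⟩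
    · have h := ((isEllipticWPBaileyPair_base_zero α₀ β₀ a _ _).2 hpair).quadratic (by simp) ha0 hk0
        hq0 (by
          constructor <;> intro j <;> rw [modTheta_base_zero, sub_ne_zero]
          · rw [← pow_succ']; exact (hq j).symm
          · exact (ha j).symm
          · exact (hk j).symm
          · exact (hm j).symm)
      simpa only [IsEllipticWPBaileyPair, IsBasicWPBaileyPair, ellAlphaNew, basicAlphaNew,
        ellBetaNew, basicBetaNew, ellPoch_base_zero, modTheta_base_zero] using h
    · unfold ellAlphaNew basicAlphaNew
      split_ifs
      · exact hα _
      · exact tendsto_const_nhds
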